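/- Let $(W,P)$ be one of the pairs $(A_n, A_{k-1}\times A_{n-k})$ with $1\le k\le n$, $(C_n,A_{n-1})$ with $n\ge 2$, or $(D_n,A_{n-1})$ with $n\ge 2$ (here $D_2=A_1\times A_1$ and $D_3=A_3$). So $W$ is a Coxeter group with simple reflections $s_i$ ($i \in I$), length function $\ell$ and Coxeter matrix $(m_{i,j})$, and $P$ is the parabolic subgroup generated by all the simple reflections but one: an arbitrary one in type $A$, the one with long simple root in type $C$, and one of the two forming the fork in type $D$ (for $D_n$: nodes $1'',1,2,\dots,n-1$ where $1,2,\dots,n-1$ is a chain and $1''$ is joined to $2$ only; $s_{1''}$ is omitted). Let ${}^PW$ be the set of minimal length representatives of the cosets in $P\backslash W$, and let $\varnothing\in{}^PW$ be the identity element. The $(W,P)$-Temperley--Lieb algebra ${\rm TL}={\rm TL}_{(W,P)}(q)$ is the unital associative $\mathbb Z[q,q^{-1}]$-algebra generated by ${\sf 1}_\lambda$ ($\lambda\in{}^PW$) and $E_i$ ($i\in I$) subject to: * ${\sf 1}=\sum_{\lambda\in {}^PW}{\sf 1}_\lambda$ and ${\sf 1}_\lambda{\sf 1}_\mu=\delta_{\lambda,\mu}{\sf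 1}_\lambda$; and ${\sf 1}_\lambda E_i{\sf 1}_\mu=0$ unless $\lambda s_i\in{}^PW$ and $\mu\in\{\lambda,\lambda s_i\}$; * ${\sf 1}_\mu E_i{\sf 1}_\lambda E_i{\sf 1}_\nu=q^{\ell(\lambda s_i)-\ell(\lambda)}\,{\sf 1}_\mu E_i{\sf 1}_\nu$ if $\lambda,\lambda s_i\in{}^PW$ and $\mu,\nu\in\{\lambda,\lambda s_i\}$; * $E_iE_j=E_jE_i$ if $m_{i,j}=2$, and $E_iE_jE_i=E_i$ if $m_{i,j}=3$; * ${\sf 1}_\mu E_i{\sf 1}_\lambda E_j{\sf 1}_\lambda E_i{\sf 1}_\nu={\sf 1}_\mu E_i{\sf 1}_\nu$ if $m_{i,j}=4$, the simple root of $s_i$ is short, $\lambda,\lambda s_i,\lambda s_j\in{}^PW$ and $\mu,\nu\in\{\lambda,\lambda s_i\}$. The anti-spherical module is $\varnothing\,{\rm TL}:={\sf 1}_\varnothing\,{\rm TL}$, regarded as a $\mathbb Z[q,q^{-1}]$-module. The extended Bruhat graph has vertex set ${}^PW$, and an edge $\lambda\xrightarrow{\,i\,}\mu$ whenever $\lambda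 s_i\in{}^PW$ and $\mu\in\{\lambda,\lambda s_i\}$; its degree is $0$ if $\mu=\lambda s_i$, and if $\mu=\lambda$ it is $1$ or $-1$ according as $\ell(\lambda s_i)>\ell(\lambda)$ or $\ell(\lambda s_i)<\ell(\lambda)$. For a path $\mathsf T:\lambda_1\xrightarrow{i_1}\lambda_2\xrightarrow{i_2}\cdots\xrightarrow{i_{k-1}}\lambda_k$, the degree $\deg\mathsf T$ is the sum of the degrees of its edges, the weight $w(\mathsf T)$ is the word $s_{i_1}s_{i_2}\cdots s_{i_{k-1}}$, and $e_{\mathsf T}:={\sf 1}_{\lambda_1}E_{i_1}{\sf 1}_{\lambda_2}E_{i_2}\cdots E_{i_{k-1}}{\sf 1}_{\lambda_k}$. For each $\mu\in{}^PW$ fix a path $\mathsf T^\mu$ of shortest possible length from $\varnothing$ to $\mu$, and let ${\rm Path}(\lambda,\mathsf T^\mu)$ be the set of paths $\mathsf T$ from $\varnothing$ to $\lambda$ with $w(\mathsf T)=w(\mathsf T^\mu)$. Regarded as a $\mathbb Z$-algebra, ${\rm TL}$ is $\mathbb Z$-graded, with $\deg q^{n}=n$ $(n\in\mathbb Z)$,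 $\deg {\sf 1}_\lambda=0$, and $\deg({\sf 1}_\lambda E_i{\sf 1}_\mu)$ equal to the degree of the edge $\lambda\xrightarrow{\,i\,}\mu$. That is, if ${\rm TL}_d$ is the additive subgroup generated by the products of these elements of total degree $d$, then ${\rm TL}=\bigoplus_{d\in\mathbb Z}{\rm TL}_d$. Moreover, for every choice of the paths $\mathsf T^\mu$: 1. The elements $e_{\mathsf T}$, indexed by $\mu,\lambda\in{}^PW$ and $\mathsf T\in{\rm Path}(\lambda,\mathsf T^\mu)$, form a $\mathbb Z[q,q^{-1}]$-basis of the anti-spherical module $\varnothing\,{\rm TL}$. 2. For $\mathsf T\in{\rm Path}(\lambda,\mathsf T^\mu)$ one has $e_{\mathsf T}=\varnothing e_\mu\lambda:={\sf 1}_\varnothing\,(E_{j_1}\cdots E_{j_r})\,{\sf 1}_\lambda$ for every reduced expression $\mu=s_{j_1}\cdots s_{j_r}$. 3. $\deg e_{\mathsf T}=\deg\mathsf T$, that is, $e_{\mathsf T}\in{\rm TL}_{\deg\mathsf T}$. 4. $|{\rm Path}(\lambda,\mathsf T^\mu)|\le 1$ for all $\lambda,\mu\in{}^PW$. -/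

import Mathlib

/-!
The `(W, P)`-Temperley--Lieb algebra of a parabolic Coxeter system, its anti-spherical module, and
paths on the extended Bruhat graph, for the pairs `(A_n, A_{k-1} × A_{n-k})`, `(C_n, A_{n-1})`,
`(D_n, A_{n-1})`.
-/

/-- A Coxeter matrix on a finite set of nodes, the set of nodes whose simple root is short (this is
only used for pairs of nodes with `m = 4`), and the set of nodes generating the parabolic. -/
structure ParabolicDatum where
  rank : ℕ
  coxMatrix : CoxeterMatrix (Fin rank)
  short : Set (Fin rank)
  parabolicNodes : Set (Fin rank)

/-- The Coxeter matrix of type `D_n` for `n ≥ 2`: the nodes `1, 2, …, n-1` form a chain, and the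
node `0` (often written `1''`) is joined to the node `2` only. This covers `D_2 = A_1 × A_1` and
`D_3 = A_3`, for which `CoxeterMatrix.D` is a different matrix. -/
def coxeterMatrixForkD (n : ℕ) : CoxeterMatrix (Fin n) where
  M := Matrix.of fun i j : Fin n ↦
    if i = j then 1
    else if ((i : ℕ) = 0 ∧ (j : ℕ) = 2) ∨ ((j : ℕ) = 0 ∧ (i : ℕ) = 2) then 3
    else if (1 ≤ (i : ℕ) ∧ (i : ℕ) + 1 = j) ∨ (1 ≤ (j : ℕ) ∧ (j : ℕ) + 1 = i) then 3
    else 2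
  isSymm := by
    ext i j
    simp only [Matrix.transpose_apply, Matrix.of_apply]
    grind
  diagonal := by simp
  off_diagonal := by
    intro i j h
    simp only [Matrix.of_apply]
    grind

namespace ParabolicDatum

/-- `(A_n, A_{k-1} × A_{n-k})`: the parabolic omits one arbitrary node of the chain of `n` nodes. -/
def typeA (n : ℕ) (k : Fin n) : ParabolicDatum where
  rank := n
  coxMatrix := CoxeterMatrix.A n
  short := Set.univ
  parabolicNodes := {i | i ≠ k}

/-- `(C_n, A_{n-1})`: in `CoxeterMatrix.B n` (the Coxeter matrix of types `B_n` and `C_n`) the last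
two nodes have `m = 4`. In type `C_n` the last node is the one with a long root, and it is the
node omitted by the parabolic. -/
def typeC (n : ℕ) : ParabolicDatum where
  rank := n
  coxMatrix := CoxeterMatrix.B n
  short := {i | (i : ℕ) + 1 ≠ n}
  parabolicNodes := {i | (i : ℕ) + 1 ≠ n}

/-- `(D_n, A_{n-1})`: the parabolic omits one of the two nodes of the fork. -/
def typeD (n : ℕ) : ParabolicDatum where
  rank := n
  coxMatrix := coxeterMatrixForkD n
  short := Set.univ
  parabolicNodes := {i | (i : ℕ) ≠ 0}

/-- The pair is `(A_n, A_{k-1} × A_{n-k})` with `1 ≤ k ≤ n`, or `(C_n, A_{n-1})` with `n ≥ 2`, or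
`(D_n, A_{n-1})` with `n ≥ 2`. -/
def IsClassicalACD (D : ParabolicDatum) : Prop :=
  (∃ (n : ℕ) (k : Fin n), D = typeA n k) ∨
  (∃ n : ℕ, 2 ≤ n ∧ D = typeC n) ∨
  (∃ n : ℕ, 2 ≤ n ∧ D = typeD n)

section CosetRepresentatives

/-- The Coxeter group. -/
abbrev W (D : ParabolicDatum) : Type := D.coxMatrix.Group

/-- The Coxeter system. -/
abbrev cs (D : ParabolicDatum) : CoxeterSystem D.coxMatrix D.W := D.coxMatrix.toCoxeterSystem

/-- The parabolic subgroup `P`. -/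
def parabolic (D : ParabolicDatum) : Subgroup D.W :=
  Subgroup.closure (D.cs.simple '' D.parabolicNodes)

/-- `w` has minimal length in its coset `P w`. -/
def IsMinimal (D : ParabolicDatum) (w : D.W) : Prop :=
  ∀ p ∈ D.parabolic, D.cs.length w ≤ D.cs.length (p * w)

/-- The set `ᴾW` of minimal length representatives of the cosets in `P \ W`. -/
def CosetRep (D : ParabolicDatum) : Type := {w : D.W // D.IsMinimal w}

/-- The representative `∅` of the identity coset. -/
def vac (D : ParabolicDatum) : D.CosetRep := ⟨1, fun p _ => by simp⟩

/-- There is an edge labelled `i` from `x` to `y` in the extended Bruhat graph: both `x` and `x s_i`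
are in `ᴾW`, and `y` is `x` or `x s_i`. -/
def IsEdge (D : ParabolicDatum) (x y : D.CosetRep) (i : Fin D.rank) : Prop :=
  D.IsMinimal (x.1 * D.cs.simple i) ∧ (y.1 = x.1 ∨ y.1 = x.1 * D.cs.simple i)

/-- The extended Bruhat graph. -/
instance (D : ParabolicDatum) : Quiver D.CosetRep where
  Hom x y := {i : Fin D.rank // D.IsEdge x y i}

open Classical in
/-- The degree of an edge: `0` for `x → x s_i`; for a loop at `x` labelled `i` it is `1` if
`x s_i > x` and `-1` if `x s_i < x` (Bruhat order on these two elements is comparison of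
lengths). -/
noncomputable def edgeDeg (D : ParabolicDatum) {x y : D.CosetRep} (e : x ⟶ y) : ℤ :=
  if y = x then
    if D.cs.length x.1 < D.cs.length (x.1 * D.cs.simple e.1) then 1 else -1
  else 0

/-- The degree of a path: the sum of the degrees of its edges. -/
noncomputable def pathDeg (D : ParabolicDatum) {x : D.CosetRep} :
    {y : D.CosetRep} → Quiver.Path x y → ℤ
  | _, .nil => 0
  | _, .cons p e => pathDeg D p + D.edgeDeg e

/-- The weight of a path: the list of the labels of its edges, in order. -/
def pathWord (D : ParabolicDatum) {x : D.CosetRep} :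
    {y : D.CosetRep} → Quiver.Path x y → List (Fin D.rank)
  | _, .nil => []
  | _, .cons p e => pathWord D p ++ [e.1]

/-- A path from `∅` to `y` is reduced if no path from `∅` to `y` is shorter. -/
def IsReducedPath (D : ParabolicDatum) {y : D.CosetRep} (p : Quiver.Path D.vac y) : Prop :=
  ∀ p' : Quiver.Path D.vac y, p.length ≤ p'.length

/-- `Path(x, T)`: the paths from `∅` to `x` with the same weight as `T`. -/
def pathsLike (D : ParabolicDatum) (x : D.CosetRep) {y : D.CosetRep} (T : Quiver.Path D.vac y) :
    Set (Quiver.Path D.vac x) :=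
  {S | D.pathWord S = D.pathWord T}

end CosetRepresentatives

section TemperleyLieb

/-- The generators of the `(W, P)`-Temperley--Lieb algebra. -/
inductive TLGen (D : ParabolicDatum) : Type
  | idem (x : D.CosetRep) : TLGen D
  | cupcap (i : Fin D.rank) : TLGen D

/-- The free `ℤ[q, q⁻¹]`-algebra on the generators. -/
abbrev FreeTL (D : ParabolicDatum) : Type := FreeAlgebra (LaurentPolynomial ℤ) D.TLGen

/-- `1_x` in the free algebra. -/
noncomputable def freeOne (D : ParabolicDatum) (x : D.CosetRep) : D.FreeTL := FreeAlgebra.ι _ (.idem x)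

/-- `E_i` in the free algebra. -/
noncomputable def freeE (D : ParabolicDatum) (i : Fin D.rank) : D.FreeTL := FreeAlgebra.ι _ (.cupcap i)

/-- The defining relations of the `(W, P)`-Temperley--Lieb algebra. In `one_eq_sum`, `F` is the
finite set of all elements of `ᴾW`. -/
inductive TLRel (D : ParabolicDatum) : D.FreeTL → D.FreeTL → Prop
  | one_eq_sum (F : Finset D.CosetRep) (hF : ∀ x, x ∈ F) :
      TLRel D 1 (∑ x ∈ F, D.freeOne x)
  | one_mul_self (x : D.CosetRep) :
      TLRel D (D.freeOne x * D.freeOne x) (D.freeOne x)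
  | one_mul_ne (x y : D.CosetRep) (hxy : x ≠ y) :
      TLRel D (D.freeOne x * D.freeOne y) 0
  | not_edge (x y : D.CosetRep) (i : Fin D.rank) (h : ¬ D.IsEdge x y i) :
      TLRel D (D.freeOne x * D.freeE i * D.freeOne y) 0
  | square (i : Fin D.rank) (x y z : D.CosetRep) (hy : D.IsEdge x y i) (hz : D.IsEdge x z i) :
      TLRel D (D.freeOne y * D.freeE i * D.freeOne x * D.freeE i * D.freeOne z)
        ((LaurentPolynomial.T
            ((D.cs.length (x.1 * D.cs.simple i) : ℤ) - (D.cs.length x.1 : ℤ)) :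
            LaurentPolynomial ℤ) • (D.freeOne y * D.freeE i * D.freeOne z))
  | comm (i j : Fin D.rank) (h : D.coxMatrix i j = 2) :
      TLRel D (D.freeE i * D.freeE j) (D.freeE j * D.freeE i)
  | three (i j : Fin D.rank) (h : D.coxMatrix i j = 3) :
      TLRel D (D.freeE i * D.freeE j * D.freeE i) (D.freeE i)
  | four (i j : Fin D.rank) (h : D.coxMatrix i j = 4) (hi : i ∈ D.short) (x y z : D.CosetRep)
      (hj : D.IsMinimal (x.1 * D.cs.simple j)) (hy : D.IsEdge x y i) (hz : D.IsEdge x z i) :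
      TLRel D
        (D.freeOne y * D.freeE i * D.freeOne x * D.freeE j * D.freeOne x * D.freeE i * D.freeOne z)
        (D.freeOne y * D.freeE i * D.freeOne z)

/-- The `(W, P)`-Temperley--Lieb algebra over `ℤ[q, q⁻¹]`, where `q` is `LaurentPolynomial.T 1`. -/
abbrev TL (D : ParabolicDatum) : Type := RingQuot D.TLRel

/-- The idempotent `1_x`. -/
noncomputable def one (D : ParabolicDatum) (x : D.CosetRep) : D.TL :=
  RingQuot.mkAlgHom (LaurentPolynomial ℤ) D.TLRel (D.freeOne x)

/-- The generator `E_i`. -/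
noncomputable def E (D : ParabolicDatum) (i : Fin D.rank) : D.TL :=
  RingQuot.mkAlgHom (LaurentPolynomial ℤ) D.TLRel (D.freeE i)

/-- The product `E_{i_1} ⋯ E_{i_k}` of a word. -/
noncomputable def wordE (D : ParabolicDatum) (ω : List (Fin D.rank)) : D.TL := (ω.map D.E).prod

/-- The element `1_{x_1} E_{i_1} 1_{x_2} E_{i_2} ⋯ E_{i_{k-1}} 1_{x_k}` of a path. -/
noncomputable def pathElt (D : ParabolicDatum) {x : D.CosetRep} :
    {y : D.CosetRep} → Quiver.Path x y → D.TL
  | _, .nil => D.one x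
  | y, .cons p e => pathElt D p * D.E e.1 * D.one y

/-- `IsMonomialOfDegree d a`: `a` is a product of homogeneous generators `q^n` (of degree `n`),
`1_x` (of degree `0`) and `1_x E_i 1_y` for edges `x → y` labelled `i` (of the degree of the edge),
with total degree `d`. -/
inductive IsMonomialOfDegree (D : ParabolicDatum) : ℤ → D.TL → Prop
  | q (n : ℤ) : IsMonomialOfDegree D n
      (algebraMap (LaurentPolynomial ℤ) D.TL (LaurentPolynomial.T n))
  | idem (x : D.CosetRep) : IsMonomialOfDegree D 0 (D.one x)
  | edge {x y : D.CosetRep} (e : x ⟶ y) :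
      IsMonomialOfDegree D (D.edgeDeg e) (D.one x * D.E e.1 * D.one y)
  | mul {d d' : ℤ} {a a' : D.TL} (h : IsMonomialOfDegree D d a) (h' : IsMonomialOfDegree D d' a') :
      IsMonomialOfDegree D (d + d') (a * a')

/-- The component of degree `d` of the algebra (as a `ℤ`-algebra). -/
noncomputable def component (D : ParabolicDatum) (d : ℤ) : AddSubgroup D.TL :=
  AddSubgroup.closure {a | D.IsMonomialOfDegree d a}

/-- The anti-spherical module: the right ideal `1_∅ TL`, as a `ℤ[q, q⁻¹]`-module. -/
noncomputable def antispherical (D : ParabolicDatum) : Submodule (LaurentPolynomial ℤ) D.TL :=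
  LinearMap.range (LinearMap.mulLeft (LaurentPolynomial ℤ) (D.one D.vac))

end TemperleyLieb

end ParabolicDatum

/-! The cosets in `P \ W` are encoded by 0/1-sequences. `W` acts on integer sequences by affine
reflections, `P` fixes the initial sequence, and a weighted sum of the entries, the height, changes
by -1, 0 or 1 under a simple reflection. The minimal representatives are the elements whose length
equals their height (`isMinimal_iff`). So `x` is determined by its sequence, and `x s_i` is again
minimal iff the pairing `d i x` is nonzero. As pairings lie in {-1, 0, 1}, distinct descents commute
(`coxMatrix_eq_two`), hence the product of the `E_i` along a reduced word depends only on the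
element (`Asc.wordE_eq`).

Uniqueness of paths is cup diagram combinatorics. Over the end points of all paths with the weight
of `μ`, each zero of `μ` is either frozen at 0 or complementary to a fixed later entry
(`Asc.bits_linked`). Hence two paths never merge at an ascending step (`Asc.not_reach_act`,
`Asc.path_unique`), and expanding `∅ e_μ λ` over paths leaves at most one term (`Asc.wordElt_eq`).

Spanning: right multiplication by an edge raises the length of `μ` by at most one, by the
straightening in `Asc.wordElt_mul_edge_mem`.

Independence: send an edge `x → y` labelled `i` to a matrix unit tensored with `q^deg` times an
idempotent matrix for `E_i`. The degrees take care of the powers of `q`, so only idempotents with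
`E_i E_j E_i = E_i` are needed; `loopFamily` builds them from a root of `ζ² - ζ + 1`. The row of `∅`
is unitriangular for the length (`Asc.loopWord_apply`).

Grading: as the relations are homogeneous, there is a coaction sending a homogeneous `a` to `a
t^deg` and `q` to `q t`. It separates the degrees. -/

/-- The elementary moves on binary sequences by which the simple reflections act. -/
inductive BitMove : Type
  | swap (p : ℕ)
  | flip
  | flipPair

/-! ### Affine reflections on integer sequences. -/

namespace BitMove

/-- The direction in which a move changes a sequence. -/
def root : BitMove → ℕ → ℤ
  | swap p => Pi.single (p + 1) 1 - Pi.single p 1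
  | flip => Pi.single 0 1
  | flipPair => Pi.single 0 1 + Pi.single 1 1

/-- The multiple of the root which a move adds to a sequence. -/
def pair : BitMove → (ℕ → ℤ) → ℤ
  | swap p, b => b p - b (p + 1)
  | flip, b => 1 - 2 * b 0
  | flipPair, b => 1 - b 0 - b 1

/-- The action of a move on a sequence. -/
def refl (κ : BitMove) (b : ℕ → ℤ) : ℕ → ℤ := b + κ.pair b • κ.root

/-- The Cartan integer of two moves. -/
def cartan (κ κ' : BitMove) : ℤ := κ'.pair 0 - κ'.pair κ.root

/-- `pair` is affine; `cartan` is minus its linear part on the root, so that a move is a reflection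
and `cartan_self` gives 2. -/
lemma pair_add_smul (κ κ' : BitMove) (b : ℕ → ℤ) (t : ℤ) :
    κ'.pair (b + t • κ.root) = κ'.pair b - t * κ.cartan κ' := by
  cases κ' <;> simp [pair, cartan] <;> ring

lemma pair_refl (κ κ' : BitMove) (b : ℕ → ℤ) :
    κ'.pair (κ.refl b) = κ'.pair b - κ.pair b * κ.cartan κ' := pair_add_smul ..

lemma cartan_self (κ : BitMove) : κ.cartan κ = 2 := by
  cases κ <;> simp [cartan, pair, root]

lemma refl_refl (κ : BitMove) (b : ℕ → ℤ) : κ.refl (κ.refl b) = b := by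
  simp only [refl, pair_add_smul, cartan_self]
  module

lemma refl_of_pair_eq_zero {κ : BitMove} {b : ℕ → ℤ} (h : κ.pair b = 0) : κ.refl b = b := by
  simp [refl, h]

lemma refl_comm {κ κ' : BitMove} (h : κ.cartan κ' = 0) (h' : κ'.cartan κ = 0) (b : ℕ → ℤ) :
    κ.refl (κ'.refl b) = κ'.refl (κ.refl b) := by
  simp only [refl, pair_add_smul, h, h']
  module

lemma refl_pow_two {κ κ' : BitMove} (h : κ.cartan κ' = 0) (h' : κ'.cartan κ = 0) (b : ℕ → ℤ) :
    κ.refl (κ'.refl (κ.refl (κ'.refl b))) = b := by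
  rw [refl_comm h h', refl_refl, refl_refl]

lemma refl_pow_three {κ κ' : BitMove} (h : κ.cartan κ' = -1) (h' : κ'.cartan κ = -1) (b : ℕ → ℤ) :
    κ.refl (κ'.refl (κ.refl (κ'.refl (κ.refl (κ'.refl b))))) = b := by
  simp only [refl, pair_add_smul, h, h', cartan_self]
  module

lemma refl_pow_four {κ κ' : BitMove}
    (h : (κ.cartan κ' = -2 ∧ κ'.cartan κ = -1) ∨ (κ.cartan κ' = -1 ∧ κ'.cartan κ = -2))
    (b : ℕ → ℤ) :
    κ.refl (κ'.refl (κ.refl (κ'.refl (κ.refl (κ'.refl (κ.refl (κ'.refl b))))))) = b := by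
  rcases h with ⟨h, h'⟩ | ⟨h, h'⟩ <;>
  · simp only [refl, pair_add_smul, h, h', cartan_self]
    module

/-- A move, as a permutation of the set of integer sequences. -/
def perm (κ : BitMove) : Equiv.Perm (ℕ → ℤ) := ⟨κ.refl, κ.refl, κ.refl_refl, κ.refl_refl⟩

/-- A sequence consists of zeros and ones. -/
def IsBits (b : ℕ → ℤ) : Prop := ∀ p, b p = 0 ∨ b p = 1

lemma IsBits.refl {b : ℕ → ℤ} (hb : IsBits b) (κ : BitMove) : IsBits (κ.refl b) := by
  intro p
  cases κ with
  | swap r =>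
    have h1 := hb r; have h2 := hb (r + 1); have h3 := hb p
    simp only [BitMove.refl, pair, root, Pi.add_apply, Pi.smul_apply, Pi.sub_apply, Pi.single_apply,
      smul_eq_mul]
    split_ifs <;> subst_vars <;> grind
  | flip =>
    have h1 := hb 0; have h3 := hb p
    simp only [BitMove.refl, pair, root, Pi.add_apply, Pi.smul_apply, Pi.single_apply, smul_eq_mul]
    split_ifs <;> subst_vars <;> grind
  | flipPair =>
    have h1 := hb 0; have h2 := hb 1; have h3 := hb p
    simp only [BitMove.refl, pair, root, Pi.add_apply, Pi.smul_apply, Pi.single_apply, smul_eq_mul]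
    split_ifs <;> subst_vars <;> grind

/-- This is the minuscule property. Most later case distinctions rest on these three values. -/
lemma IsBits.pair {b : ℕ → ℤ} (hb : IsBits b) (κ : BitMove) :
    κ.pair b = -1 ∨ κ.pair b = 0 ∨ κ.pair b = 1 := by
  cases κ with
  | swap r =>
    have h1 := hb r; have h2 := hb (r + 1)
    simp only [BitMove.pair]; grind
  | flip =>
    have h1 := hb 0
    simp only [BitMove.pair]; grind
  | flipPair =>
    have h1 := hb 0; have h2 := hb 1
    simp only [BitMove.pair]; grind

end BitMove

open BitMove

lemma braid_of_pow_three {G : Type*} [Group G] {x y : G} (hx : x * x = 1) (hy : y * y = 1)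
    (h : (x * y) ^ 3 = 1) : y * x * y = x * y * x := by
  have hx' := inv_eq_of_mul_eq_one_right hx
  have hy' := inv_eq_of_mul_eq_one_right hy
  have h1 : x * y * x * (y * x * y) = 1 := by
    rw [← h]; simp only [pow_succ, pow_zero, one_mul, mul_assoc]
  rw [eq_inv_of_mul_eq_one_right h1]
  simp only [mul_inv_rev, hx', hy', mul_assoc]

/-- The right side is the conjugate of `x` by `x * y`; for order three it is the conjugate of `y` by
`x`. Both serve to replace a conjugating element by a shorter one. -/
lemma braid_of_pow_four {G : Type*} [Group G] {x y : G} (hx : x * x = 1) (hy : y * y = 1)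
    (h : (x * y) ^ 4 = 1) : y * x * y = x * y * x * y * x := by
  have hx' := inv_eq_of_mul_eq_one_right hx
  have hy' := inv_eq_of_mul_eq_one_right hy
  have h1 : x * y * x * y * x * (y * x * y) = 1 := by
    rw [← h]; simp only [pow_succ, pow_zero, one_mul, mul_assoc]
  rw [eq_inv_of_mul_eq_one_right h1]
  simp only [mul_inv_rev, hx', hy', mul_assoc]

/-! ### Minimal coset representatives as binary sequences. -/

namespace ParabolicDatum

/-- A realization of a parabolic datum by moves on binary sequences. -/
structure BitModel (D : ParabolicDatum) where
  move : Fin D.rank → BitMove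
  init : ℕ → ℤ
  size : ℕ
  weight : ℕ → ℤ
  init_bits : IsBits init
  init_eq_zero : ∀ p, size ≤ p → init p = 0
  root_eq_zero : ∀ i p, size ≤ p → (move i).root p = 0
  -- Every root has total weight one, so the weighted sum of a sequence changes exactly by the
  -- pairing.
  weight_root : ∀ i, ∑ p ∈ Finset.range size, weight p * (move i).root p = 1
  cartan : ∀ i j, i ≠ j →
    (D.coxMatrix i j = 2 ∧ (move i).cartan (move j) = 0 ∧ (move j).cartan (move i) = 0) ∨
    (D.coxMatrix i j = 3 ∧ (move i).cartan (move j) = -1 ∧ (move j).cartan (move i) = -1) ∨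
    (D.coxMatrix i j = 4 ∧ i ∈ D.short ∧ j ∉ D.short ∧
      (move i).cartan (move j) = -2 ∧ (move j).cartan (move i) = -1) ∨
    (D.coxMatrix i j = 4 ∧ i ∉ D.short ∧ j ∈ D.short ∧
      (move i).cartan (move j) = -1 ∧ (move j).cartan (move i) = -2)
  -- Nodes joined by a simple bond are both short, so that one loop weight suffices for all such
  -- bonds.
  mem_short : ∀ i j, D.coxMatrix i j = 3 → i ∈ D.short
  pair_init : ∀ i, (i ∈ D.parabolicNodes ∧ (move i).pair init = 0) ∨
    (i ∉ D.parabolicNodes ∧ (move i).pair init = 1)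

namespace BitModel

variable {D : ParabolicDatum} (B : BitModel D)

lemma isLiftable : D.coxMatrix.IsLiftable fun i ↦ (B.move i).perm := by
  intro i j
  by_cases hij : i = j
  · subst hij
    rw [D.coxMatrix.diagonal, pow_one]
    ext1 b
    exact refl_refl _ b
  · rcases B.cartan i j hij with ⟨hm, h⟩ | ⟨hm, h⟩ | ⟨hm, -, -, h⟩ | ⟨hm, -, -, h⟩ <;>
    · rw [hm]
      ext1 b
      first
        | exact refl_pow_two h.1 h.2 b
        | exact refl_pow_three h.1 h.2 b
        | exact refl_pow_four (.inl h) b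
        | exact refl_pow_four (.inr h) b

/-- The binary sequence of an element of the Coxeter group. -/
noncomputable def bits (w : D.W) : ℕ → ℤ := D.cs.lift ⟨_, B.isLiftable⟩ w⁻¹ B.init

@[simp] lemma bits_one : B.bits 1 = B.init := by simp [bits]

/-- The inverse in `bits` turns right multiplication into the action of a move, while a left factor
in `P` acts on `init`, which it fixes. -/
lemma bits_mul_simple (w : D.W) (i : Fin D.rank) :
    B.bits (w * D.cs.simple i) = (B.move i).refl (B.bits w) := by
  rw [bits, mul_inv_rev, D.cs.inv_simple, map_mul, CoxeterSystem.lift_apply_simple]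
  rfl

lemma isBits_bits (w : D.W) : IsBits (B.bits w) := by
  induction w using D.cs.simple_induction_right with
  | one => simpa using B.init_bits
  | mul_simple_right w i h =>
    rw [bits_mul_simple]
    exact h.refl _

lemma bits_eq_zero (w : D.W) {p : ℕ} (hp : B.size ≤ p) : B.bits w p = 0 := by
  induction w using D.cs.simple_induction_right with
  | one => simpa using B.init_eq_zero p hp
  | mul_simple_right w i h =>
    rw [bits_mul_simple]
    simp [BitMove.refl, h, B.root_eq_zero i p hp]

/-- The pairing of the sequence of `w` with a simple root. -/
noncomputable def pr (i : Fin D.rank) (w : D.W) : ℤ := (B.move i).pair (B.bits w)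

lemma pr_cases (i : Fin D.rank) (w : D.W) : B.pr i w = -1 ∨ B.pr i w = 0 ∨ B.pr i w = 1 :=
  (B.isBits_bits w).pair _

lemma pr_mul_simple (i j : Fin D.rank) (w : D.W) :
    B.pr j (w * D.cs.simple i) = B.pr j w - B.pr i w * (B.move i).cartan (B.move j) := by
  rw [pr, bits_mul_simple, pair_refl]; rfl

lemma pr_mul_simple_self (i : Fin D.rank) (w : D.W) :
    B.pr i (w * D.cs.simple i) = -B.pr i w := by
  rw [pr_mul_simple, cartan_self]; ring

lemma bits_mul_simple_of_pr_eq_zero {i : Fin D.rank} {w : D.W} (h : B.pr i w = 0) :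
    B.bits (w * D.cs.simple i) = B.bits w := by
  rw [bits_mul_simple]; exact refl_of_pair_eq_zero h

lemma pr_eq_of_bits_eq {w w' : D.W} (h : B.bits w = B.bits w') (i : Fin D.rank) :
    B.pr i w = B.pr i w' := by rw [pr, h]; rfl

/-- The height of an element of the Coxeter group. -/
noncomputable def ht (w : D.W) : ℤ :=
  ∑ p ∈ Finset.range B.size, B.weight p * (B.bits w p - B.init p)

@[simp] lemma ht_one : B.ht 1 = 0 := by simp [ht]

lemma ht_eq_of_bits_eq {w w' : D.W} (h : B.bits w = B.bits w') : B.ht w = B.ht w' := by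
  rw [ht, h]; rfl

lemma ht_mul_simple (w : D.W) (i : Fin D.rank) :
    B.ht (w * D.cs.simple i) = B.ht w + B.pr i w := by
  rw [ht, ht, bits_mul_simple, ← mul_one (B.pr i w), ← B.weight_root i, Finset.mul_sum,
    ← Finset.sum_add_distrib]
  refine Finset.sum_congr rfl fun p _ ↦ ?_
  simp only [BitMove.refl, pr, Pi.add_apply, Pi.smul_apply, smul_eq_mul]
  ring

lemma ht_wordProd_le (ω : List (Fin D.rank)) : B.ht (D.cs.wordProd ω) ≤ ω.length := by
  induction ω using List.reverseRecOn with
  | nil => simp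
  | append_singleton ω i ih =>
    rw [D.cs.wordProd_append, D.cs.wordProd_singleton, ht_mul_simple]
    have := B.pr_cases i (D.cs.wordProd ω)
    simp only [List.length_append, List.length_singleton]
    push_cast
    omega

lemma ht_le_length (w : D.W) : B.ht w ≤ D.cs.length w := by
  obtain ⟨ω, hω, rfl⟩ := D.cs.exists_isReduced w
  rw [hω.eq]
  exact B.ht_wordProd_le ω

/-- The length of `w` is its height. -/
def IsShort (w : D.W) : Prop := (D.cs.length w : ℤ) = B.ht w

lemma isShort_one : B.IsShort 1 := by simp [IsShort]

lemma IsShort.mul_simple {B : BitModel D} {w : D.W} (hw : B.IsShort w) {i : Fin D.rank}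
    (h : B.pr i w = 1) : B.IsShort (w * D.cs.simple i) := by
  have h1 := B.ht_le_length (w * D.cs.simple i)
  have h2 := D.cs.length_mul_simple w i
  have h3 := B.ht_mul_simple w i
  unfold IsShort at *
  omega

/-- At a right descent the length drops by one; the height is bounded by the length, so it must drop
as well. -/
lemma IsShort.exists_eq_mul_simple {B : BitModel D} {w : D.W} (hw : B.IsShort w) (h1 : w ≠ 1) :
    ∃ u i, w = u * D.cs.simple i ∧ B.IsShort u ∧ B.pr i u = 1 ∧
      D.cs.length w = D.cs.length u + 1 := by
  obtain ⟨i, hi⟩ := D.cs.exists_rightDescent_of_ne_one h1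
  rw [CoxeterSystem.isRightDescent_iff] at hi
  have h3 := B.ht_mul_simple w i
  have h4 := B.ht_le_length (w * D.cs.simple i)
  have h5 := B.pr_cases i w
  unfold IsShort at hw
  refine ⟨w * D.cs.simple i, i, (D.cs.simple_mul_simple_cancel_right i).symm, ?_, ?_, hi.symm⟩
  · unfold IsShort; omega
  · rw [pr_mul_simple_self]; omega

/-- Two different simple reflections which both lower (or both raise) an element commute. -/
lemma coxMatrix_eq_two {i j : Fin D.rank} (hij : i ≠ j) {w : D.W}
    (h : (B.pr i w = 1 ∧ B.pr j w = 1) ∨ (B.pr i w = -1 ∧ B.pr j w = -1)) :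
    D.coxMatrix i j = 2 ∧ (B.move i).cartan (B.move j) = 0 ∧ (B.move j).cartan (B.move i) = 0 := by
  have h1 := B.pr_mul_simple i j w
  have h2 := B.pr_cases j (w * D.cs.simple i)
  rcases B.cartan i j hij with h3 | ⟨-, h3, -⟩ | ⟨-, -, -, h3, -⟩ | ⟨-, -, -, h3, -⟩
  · exact h3
  -- A negative Cartan integer would push the second pairing out of {-1, 0, 1}.
  all_goals
    rw [h3] at h1
    rcases h with h | h <;> rw [h.1, h.2] at h1 <;> omega

end BitModel

lemma simple_comm {D : ParabolicDatum} {i j : Fin D.rank} (h : D.coxMatrix i j = 2) :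
    D.cs.simple i * D.cs.simple j = D.cs.simple j * D.cs.simple i := by
  have h1 := D.cs.simple_mul_simple_pow i j
  rw [h, pow_two, mul_eq_one_iff_eq_inv, mul_inv_rev, D.cs.inv_simple, D.cs.inv_simple] at h1
  exact h1

namespace BitModel

variable {D : ParabolicDatum} (B : BitModel D)

/-- Induction on the length: a last letter `j` different from `i` is also a descent, so it commutes
with `s_i`, and `s_i` can be removed from the shorter element first. -/
lemma IsShort.mul_simple_of_neg {B : BitModel D} {w : D.W} (hw : B.IsShort w) {i : Fin D.rank}
    (h : B.pr i w = -1) : B.IsShort (w * D.cs.simple i) := by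
  induction hn : D.cs.length w using Nat.strong_induction_on generalizing w with
  | _ n ih =>
  have hw1 : w ≠ 1 := by
    rintro rfl
    have := B.pair_init i
    simp only [pr, bits_one] at h
    omega
  obtain ⟨u, j, rfl, hu, hj, hl⟩ := hw.exists_eq_mul_simple hw1
  by_cases hij : i = j
  · subst hij
    rwa [D.cs.simple_mul_simple_cancel_right]
  have hj' : B.pr j (u * D.cs.simple j) = -1 := by rw [pr_mul_simple_self, hj]
  obtain ⟨hm, hc, hc'⟩ := B.coxMatrix_eq_two hij (.inr ⟨h, hj'⟩)
  have h1 : B.pr i u = -1 := by rw [pr_mul_simple, hc'] at h; omega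
  have h2 := ih _ (by omega) hu h1 rfl
  have h3 : B.pr j (u * D.cs.simple i) = 1 := by rw [pr_mul_simple, hc]; omega
  rw [mul_assoc, ← simple_comm hm, ← mul_assoc]
  exact h2.mul_simple h3

lemma IsShort.mul_simple_of_ne {B : BitModel D} {w : D.W} (hw : B.IsShort w) {i : Fin D.rank}
    (h : B.pr i w ≠ 0) : B.IsShort (w * D.cs.simple i) := by
  rcases B.pr_cases i w with h1 | h1 | h1
  exacts [hw.mul_simple_of_neg h1, absurd h1 h, hw.mul_simple h1]

lemma exists_isShort (w : D.W) : ∃ c, B.IsShort c ∧ B.bits c = B.bits w := by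
  induction w using D.cs.simple_induction_right with
  | one => exact ⟨1, B.isShort_one, rfl⟩
  | mul_simple_right w i ih =>
  obtain ⟨c, hc, h⟩ := ih
  by_cases h0 : B.pr i c = 0
  · refine ⟨c, hc, ?_⟩
    rw [B.bits_mul_simple_of_pr_eq_zero (by rwa [← B.pr_eq_of_bits_eq h]), h]
  · exact ⟨c * D.cs.simple i, hc.mul_simple_of_ne h0, by rw [bits_mul_simple, bits_mul_simple, h]⟩

/-- The sequence determines the height, hence the length, and the sign of every pairing. So a
descent of one element is a descent of the other and can be stripped from both. -/
lemma IsShort.eq {B : BitModel D} {w w' : D.W} (hw : B.IsShort w) (hw' : B.IsShort w')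
    (h : B.bits w = B.bits w') : w = w' := by
  induction hn : D.cs.length w generalizing w w' with
  | zero =>
    have h1 := B.ht_eq_of_bits_eq h
    unfold IsShort at hw hw'
    rw [D.cs.length_eq_zero_iff.1 hn, eq_comm, ← D.cs.length_eq_zero_iff]
    omega
  | succ n ih =>
    have hw1 : w ≠ 1 := by rintro rfl; simp at hn
    have hl : D.cs.length w = D.cs.length w' := by
      have h1 := B.ht_eq_of_bits_eq h
      unfold IsShort at hw hw'
      omega
    obtain ⟨u, i, rfl, hu, hi, hul⟩ := hw.exists_eq_mul_simple hw1
    have h2 : B.pr i w' = -1 := by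
      rw [← B.pr_eq_of_bits_eq h, pr_mul_simple_self, hi]
    have h3 : u = w' * D.cs.simple i := by
      refine ih hu (hw'.mul_simple_of_neg h2) ?_ (by omega)
      rw [bits_mul_simple, ← h, bits_mul_simple, refl_refl]
    rw [h3, D.cs.simple_mul_simple_cancel_right]

/-- An element of the Coxeter group with trivial pairing is moved by the simple reflection
within its coset. -/
lemma IsShort.mul_simple_mul_inv_mem {B : BitModel D} {w : D.W} (hw : B.IsShort w)
    {i : Fin D.rank} (h : B.pr i w = 0) : w * D.cs.simple i * w⁻¹ ∈ D.parabolic := by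
  induction hn : D.cs.length w using Nat.strong_induction_on generalizing w i with
  | _ n ih =>
  by_cases hw1 : w = 1
  · subst hw1
    have := B.pair_init i
    simp only [pr, bits_one] at h
    simp only [one_mul, inv_one, mul_one]
    exact Subgroup.subset_closure ⟨i, by rcases this with h' | h' <;> [exact h'.1; omega], rfl⟩
  obtain ⟨u, j, rfl, hu, hj, hl⟩ := hw.exists_eq_mul_simple hw1
  have hij : i ≠ j := by
    rintro rfl
    rw [pr_mul_simple_self] at h
    omega
  have hp := B.pr_mul_simple j i u
  rw [h, hj] at hp
  rcases B.cartan i j hij with ⟨hm, hc, hc'⟩ | ⟨hm, hc, hc'⟩ | ⟨hm, -, -, hc, hc'⟩ |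
    ⟨hm, -, -, hc, hc'⟩
  · have h1 := ih _ (by omega) hu (i := i) (by rw [hc'] at hp; omega) rfl
    convert h1 using 1
    rw [mul_assoc u, ← simple_comm hm]
    simp [mul_assoc]
  -- By the braid relation, conjugating `s_i` by `u s_j` is conjugating `s_j` by the shorter element
  -- `u s_i`.
  · have h1 : B.pr i u = -1 := by rw [hc'] at hp; omega
    have h2 := hu.mul_simple_of_neg h1
    have h3 : B.pr j (u * D.cs.simple i) = 0 := by rw [pr_mul_simple, hj, h1, hc]; norm_num
    have hl2 : D.cs.length (u * D.cs.simple i) < D.cs.length u := by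
      have := B.ht_mul_simple u i
      unfold IsShort at hu h2
      omega
    have h4 := ih _ (by omega) h2 (i := j) h3 rfl
    convert h4 using 1
    have hb := D.cs.simple_mul_simple_pow i j
    rw [hm] at hb
    have hb' := braid_of_pow_three (D.cs.simple_mul_simple_self i) (D.cs.simple_mul_simple_self j) hb
    simp only [mul_inv_rev, D.cs.inv_simple]
    calc _ = u * (D.cs.simple j * D.cs.simple i * D.cs.simple j) * u⁻¹ := by simp only [mul_assoc]
      _ = _ := by rw [hb']; simp only [mul_assoc]
  -- With `m = 4` and `i` short, two letters are stripped: the shorter conjugating element is `u s_i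
  -- s_j`.
  · have h1 : B.pr i u = -1 := by rw [hc'] at hp; omega
    have h2 := hu.mul_simple_of_neg h1
    have h3 : B.pr j (u * D.cs.simple i) = -1 := by rw [pr_mul_simple, hj, h1, hc]; norm_num
    have h4 := h2.mul_simple_of_neg h3
    have h5 : B.pr i (u * D.cs.simple i * D.cs.simple j) = 0 := by
      rw [pr_mul_simple, h3, pr_mul_simple_self, h1, hc']; norm_num
    have hl2 : D.cs.length (u * D.cs.simple i * D.cs.simple j) < D.cs.length u := by
      have := B.ht_mul_simple u i
      have := B.ht_mul_simple (u * D.cs.simple i) j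
      unfold IsShort at hu h2 h4
      omega
    have h6 := ih _ (by omega) h4 (i := i) h5 rfl
    convert h6 using 1
    have hb := D.cs.simple_mul_simple_pow i j
    rw [hm] at hb
    have hb' := braid_of_pow_four (D.cs.simple_mul_simple_self i) (D.cs.simple_mul_simple_self j) hb
    simp only [mul_inv_rev, D.cs.inv_simple]
    calc _ = u * (D.cs.simple j * D.cs.simple i * D.cs.simple j) * u⁻¹ := by simp only [mul_assoc]
      _ = _ := by rw [hb']; simp only [mul_assoc]
  -- With `i` long, the pairing of `u` with `i` would have to be -2.
  · have := B.pr_cases i u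
    rw [hc'] at hp
    omega

/-- Elements with the same binary sequence lie in the same coset. -/
lemma IsShort.mul_inv_mem {B : BitModel D} {c : D.W} (hc : B.IsShort c) (w : D.W)
    (h : B.bits c = B.bits w) : c * w⁻¹ ∈ D.parabolic := by
  induction w using D.cs.simple_induction_right generalizing c with
  | one =>
    rw [hc.eq B.isShort_one h]
    simp
  | mul_simple_right w i ih =>
    obtain ⟨c', hc', h'⟩ := B.exists_isShort w
    have h1 := ih hc' h'
    by_cases h0 : B.pr i w = 0
    · rw [B.bits_mul_simple_of_pr_eq_zero h0, ← h'] at h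
      obtain rfl := hc.eq hc' h
      have h2 := hc.mul_simple_mul_inv_mem (i := i) (by rwa [B.pr_eq_of_bits_eq h'])
      convert D.parabolic.mul_mem h2 h1 using 1
      simp only [mul_inv_rev, D.cs.inv_simple, mul_assoc, inv_mul_cancel_left]
    · rw [bits_mul_simple, ← h', ← bits_mul_simple] at h
      rw [← B.pr_eq_of_bits_eq h'] at h0
      obtain rfl := hc.eq (hc'.mul_simple_of_ne h0) h
      convert h1 using 1
      simp [mul_assoc]

lemma bits_mul_of_mem {p : D.W} (hp : p ∈ D.parabolic) (w : D.W) :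
    B.bits (p * w) = B.bits w := by
  have key : ∀ q ∈ D.parabolic, D.cs.lift ⟨_, B.isLiftable⟩ q B.init = B.init := by
    intro q hq
    induction hq using Subgroup.closure_induction with
    | mem x hx =>
      obtain ⟨i, hi, rfl⟩ := hx
      rw [CoxeterSystem.lift_apply_simple]
      have := B.pair_init i
      exact refl_of_pair_eq_zero (by tauto)
    | one => simp
    | mul x y _ _ hx hy => rw [map_mul, Equiv.Perm.mul_apply, hy, hx]
    | inv x _ hx =>
      rw [map_inv, Equiv.Perm.inv_eq_iff_eq, hx]
  rw [bits, mul_inv_rev, map_mul, Equiv.Perm.mul_apply, key _ (inv_mem hp)]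
  rfl

/-- The minimal coset representatives are the elements whose length is their height. -/
lemma isMinimal_iff (w : D.W) : D.IsMinimal w ↔ B.IsShort w := by
  constructor
  · intro h
    obtain ⟨c, hc, hcw⟩ := B.exists_isShort w
    have h1 := h _ (hc.mul_inv_mem w hcw)
    have h2 := B.ht_le_length w
    have h3 := B.ht_eq_of_bits_eq hcw
    rw [inv_mul_cancel_right] at h1
    unfold IsShort at *
    omega
  · intro h p hp
    have h1 := B.ht_le_length (p * w)
    rw [B.ht_eq_of_bits_eq (B.bits_mul_of_mem hp w)] at h1
    unfold IsShort at h
    omega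

end BitModel

end ParabolicDatum

/-! ### The extended Bruhat graph in terms of pairings, and ascending words. -/

namespace ParabolicDatum

/-- The nodes `i`, `j` satisfy `E_i E_j E_i = E_i`, at least locally. -/
def Adj (D : ParabolicDatum) (i j : Fin D.rank) : Prop :=
  D.coxMatrix i j = 3 ∨ (D.coxMatrix i j = 4 ∧ i ∈ D.short)

namespace BitModel

open BitMove

variable {D : ParabolicDatum} (B : BitModel D)

/-- The sign of the loop labelled `i` at `x`, and zero if there is none. -/
noncomputable def d (i : Fin D.rank) (x : D.CosetRep) : ℤ := B.pr i x.1

/-- The neighbour `x s_i` of `x` if it is a minimal coset representative, and `x` otherwise. -/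
noncomputable def act (i : Fin D.rank) (x : D.CosetRep) : D.CosetRep :=
  if h : B.d i x ≠ 0 then
    ⟨x.1 * D.cs.simple i, (B.isMinimal_iff _).2 (((B.isMinimal_iff _).1 x.2).mul_simple_of_ne h)⟩
  else x

lemma isShort (x : D.CosetRep) : B.IsShort x.1 := (B.isMinimal_iff _).1 x.2

lemma ext_bits {x y : D.CosetRep} (h : B.bits x.1 = B.bits y.1) : x = y :=
  Subtype.ext ((B.isShort x).eq (B.isShort y) h)

lemma d_cases (i : Fin D.rank) (x : D.CosetRep) : B.d i x = -1 ∨ B.d i x = 0 ∨ B.d i x = 1 :=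
  B.pr_cases i x.1

lemma act_of_eq_zero {i : Fin D.rank} {x : D.CosetRep} (h : B.d i x = 0) : B.act i x = x := by
  simp [act, h]

lemma act_val {i : Fin D.rank} {x : D.CosetRep} (h : B.d i x ≠ 0) :
    (B.act i x).1 = x.1 * D.cs.simple i :=
  congrArg Subtype.val (dif_pos h)

lemma bits_act (i : Fin D.rank) (x : D.CosetRep) :
    B.bits (B.act i x).1 = (B.move i).refl (B.bits x.1) := by
  by_cases h : B.d i x = 0
  · rw [B.act_of_eq_zero h, refl_of_pair_eq_zero h]
  · rw [B.act_val h, bits_mul_simple]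

lemma d_act (i j : Fin D.rank) (x : D.CosetRep) :
    B.d j (B.act i x) = B.d j x - B.d i x * (B.move i).cartan (B.move j) := by
  rw [d, pr, bits_act, pair_refl]; rfl

@[simp] lemma d_act_self (i : Fin D.rank) (x : D.CosetRep) : B.d i (B.act i x) = -B.d i x := by
  rw [d_act, cartan_self]; ring

@[simp] lemma act_act (i : Fin D.rank) (x : D.CosetRep) : B.act i (B.act i x) = x :=
  B.ext_bits (by rw [bits_act, bits_act, refl_refl])

lemma act_ne {i : Fin D.rank} {x : D.CosetRep} (h : B.d i x ≠ 0) : B.act i x ≠ x := by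
  intro h1
  have := B.d_act_self i x
  rw [h1] at this
  omega

/-- If the pairing vanishes, `x s_i` has the same sequence as `x`; were it minimal, it would equal
`x`. -/
lemma isMinimal_mul_simple_iff (i : Fin D.rank) (x : D.CosetRep) :
    D.IsMinimal (x.1 * D.cs.simple i) ↔ B.d i x ≠ 0 := by
  refine ⟨fun h h0 ↦ ?_, fun h ↦ ?_⟩
  · have h1 := ((B.isMinimal_iff _).1 h).eq (B.isShort x) (B.bits_mul_simple_of_pr_eq_zero h0)
    exact D.cs.length_mul_simple_ne x.1 i (by rw [h1])
  · rw [← B.act_val h]; exact (B.act i x).2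

lemma isEdge_iff {x y : D.CosetRep} {i : Fin D.rank} :
    D.IsEdge x y i ↔ B.d i x ≠ 0 ∧ (y = x ∨ y = B.act i x) := by
  rw [IsEdge, isMinimal_mul_simple_iff]
  refine and_congr_right fun h ↦ ?_
  rw [← B.act_val h]
  exact or_congr Subtype.ext_iff.symm Subtype.ext_iff.symm

lemma length_mul_simple {i : Fin D.rank} {x : D.CosetRep} (h : B.d i x ≠ 0) :
    (D.cs.length (x.1 * D.cs.simple i) : ℤ) = D.cs.length x.1 + B.d i x := by
  have h1 := B.isShort (B.act i x)
  have h2 := B.isShort x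
  rw [B.act_val h] at h1
  unfold IsShort at h1 h2
  rw [h1, h2, ht_mul_simple, d]

lemma length_act (i : Fin D.rank) (x : D.CosetRep) :
    (D.cs.length (B.act i x).1 : ℤ) = D.cs.length x.1 + B.d i x := by
  by_cases h : B.d i x = 0
  · rw [B.act_of_eq_zero h, h, add_zero]
  · rw [B.act_val h, B.length_mul_simple h]

open Classical in
lemma edgeDeg_eq {x y : D.CosetRep} (e : x ⟶ y) :
    D.edgeDeg e = if y = x then B.d e.1 x else 0 := by
  have h0 := (B.isEdge_iff.1 e.2).1
  have h := B.length_mul_simple h0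
  have h1 := B.d_cases e.1 x
  rw [edgeDeg]
  split_ifs <;> first | rfl | omega

lemma act_comm {i j : Fin D.rank} (h : D.coxMatrix i j = 2) (x : D.CosetRep) :
    B.act i (B.act j x) = B.act j (B.act i x) := by
  apply B.ext_bits
  have hij : i ≠ j := by rintro rfl; simp at h
  rcases B.cartan i j hij with h1 | h1 | h1 | h1
  · simp only [bits_act]
    exact refl_comm h1.2.1 h1.2.2 _
  all_goals omega

lemma d_act_comm {i j : Fin D.rank} (h : D.coxMatrix i j = 2) (x : D.CosetRep) :
    B.d i (B.act j x) = B.d i x := by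
  have hij : i ≠ j := by rintro rfl; simp at h
  rcases B.cartan i j hij with h1 | h1 | h1 | h1
  · rw [d_act, h1.2.2]; ring
  all_goals omega

include B in
lemma coxMatrix_cases {i j : Fin D.rank} (hij : i ≠ j) : D.coxMatrix i j = 2 ∨ D.Adj i j ∨
    (i ∉ D.short ∧ D.coxMatrix i j = 4) := by
  unfold Adj
  rcases B.cartan i j hij with h1 | h1 | h1 | h1 <;> tauto

/-- `Adj i j` is exactly the condition that the Cartan integer from `j` to `i` is -1; for `m = 4`
this requires `i` to be short. -/
lemma d_act_of_adj {i j : Fin D.rank} (h : D.Adj i j) (x : D.CosetRep) :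
    B.d i (B.act j x) = B.d i x + B.d j x := by
  have hij : i ≠ j := by rintro rfl; simp [Adj] at h
  unfold Adj at h
  rcases B.cartan i j hij with ⟨h1, h2, h3⟩ | ⟨h1, h2, h3⟩ | ⟨h1, -, -, h2, h3⟩ | ⟨h1, h4, -, h2, h3⟩
  · omega
  · rw [d_act, h3]; ring
  · rw [d_act, h3]; ring
  · rw [h1] at h; simp [h4] at h

lemma d_eq_neg_of_adj {i j : Fin D.rank} (h : D.Adj i j) {x : D.CosetRep} (hi : B.d i x ≠ 0)
    (hj : B.d j x ≠ 0) : B.d j x = -B.d i x := by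
  have h1 := B.d_act_of_adj h x
  have h2 := B.d_cases i (B.act j x)
  have h3 := B.d_cases i x
  have h4 := B.d_cases j x
  omega

/-- This is why in `E_i E_j E_i` only loops labelled `j` survive in the middle. -/
lemma d_act_eq_zero_of_adj {i j : Fin D.rank} (h : D.Adj i j) {x : D.CosetRep} (hi : B.d i x ≠ 0)
    (hj : B.d j x ≠ 0) : B.d i (B.act j x) = 0 := by
  rw [B.d_act_of_adj h, B.d_eq_neg_of_adj h hi hj, add_neg_cancel]

lemma exists_eq_act {x : D.CosetRep} (hx : x ≠ D.vac) :
    ∃ u i, x = B.act i u ∧ B.d i u = 1 ∧ D.cs.length x.1 = D.cs.length u.1 + 1 := by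
  obtain ⟨u, i, h1, h2, h3, h4⟩ :=
    (B.isShort x).exists_eq_mul_simple fun h ↦ hx (Subtype.ext h)
  refine ⟨⟨u, (B.isMinimal_iff _).2 h2⟩, i, ?_, h3, h4⟩
  have h5 : B.pr i u ≠ 0 := by omega
  exact Subtype.ext (h1.trans (B.act_val (x := ⟨u, _⟩) h5).symm)

include B in
lemma finite_cosetRep : Finite D.CosetRep := by
  refine Finite.of_injective (β := Fin B.size → Prop) (fun x p ↦ B.bits x.1 p = 1) ?_
  intro x y h
  apply B.ext_bits
  ext p
  by_cases hp : p < B.size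
  · have h1 := congrFun h ⟨p, hp⟩
    have h2 := B.isBits_bits x.1 p
    have h3 := B.isBits_bits y.1 p
    simp only [eq_iff_iff] at h1
    rcases h2 with h2 | h2 <;> rcases h3 with h3 | h3 <;> simp_all
  · rw [B.bits_eq_zero _ (by omega), B.bits_eq_zero _ (by omega)]

/-- The word `ω` is a reduced expression of `x`, all prefixes of which are minimal
representatives. -/
inductive Asc : List (Fin D.rank) → D.CosetRep → Prop
  | nil : Asc [] D.vac
  | snoc {ω : List (Fin D.rank)} {x : D.CosetRep} (i : Fin D.rank) (h : Asc ω x)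
      (hi : B.d i x = 1) : Asc (ω ++ [i]) (B.act i x)

variable {B}

lemma Asc.length_eq {ω : List (Fin D.rank)} {x : D.CosetRep} (h : B.Asc ω x) :
    ω.length = D.cs.length x.1 := by
  induction h with
  | nil => simp [vac]
  | @snoc ω x i h hi ih =>
    have := B.length_act i x
    simp only [List.length_append, List.length_singleton]
    omega

lemma asc_nil_iff {x : D.CosetRep} : B.Asc [] x ↔ x = D.vac := by
  constructor
  · intro h
    generalize hω : ([] : List (Fin D.rank)) = ω at h
    cases h with
    | nil => rfl
    | snoc i h hi => simp at hω
  · rintro rfl; exact .nil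

lemma asc_append_iff {ω : List (Fin D.rank)} {i : Fin D.rank} {x : D.CosetRep} :
    B.Asc (ω ++ [i]) x ↔ B.Asc ω (B.act i x) ∧ B.d i x = -1 := by
  constructor
  · intro h
    generalize hω : ω ++ [i] = ω' at h
    cases h with
    | nil => simp at hω
    | snoc j h hi =>
      obtain ⟨rfl, hj⟩ := List.append_inj' hω rfl
      obtain rfl : i = j := by simpa using hj
      simp [h, hi]
  · rintro ⟨h, hi⟩
    have := Asc.snoc i h (by simp [hi])
    simpa using this

variable (B)

lemma exists_asc (x : D.CosetRep) : ∃ ω, B.Asc ω x := by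
  induction hn : D.cs.length x.1 using Nat.strong_induction_on generalizing x with
  | _ n ih =>
  by_cases hx : x = D.vac
  · exact ⟨[], hx ▸ .nil⟩
  · obtain ⟨u, i, rfl, hi, hl⟩ := B.exists_eq_act hx
    obtain ⟨ω, hω⟩ := ih _ (by omega) u rfl
    exact ⟨_, hω.snoc i hi⟩

/-- Removing the last letter of a reduced word lowers the length, hence also the height, so all
prefixes are again minimal representatives. -/
lemma asc_of_isReduced {ω : List (Fin D.rank)} (hω : D.cs.IsReduced ω) {x : D.CosetRep}
    (hx : D.cs.wordProd ω = x.1) : B.Asc ω x := by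
  induction ω using List.reverseRecOn generalizing x with
  | nil => exact asc_nil_iff.2 (Subtype.ext hx.symm)
  | append_singleton ω i ih =>
    rw [D.cs.wordProd_append, D.cs.wordProd_singleton] at hx
    have h1 : D.cs.wordProd ω = x.1 * D.cs.simple i := by
      rw [← hx, D.cs.simple_mul_simple_cancel_right]
    have h2 : D.cs.IsReduced ω := by simpa using hω.take ω.length
    have h3 := B.isShort x
    have h4 := B.pr_cases i x.1
    have h5 := B.ht_mul_simple x.1 i
    have h6 := B.ht_le_length (x.1 * D.cs.simple i)
    have h7 := hω.eq
    rw [D.cs.wordProd_append, D.cs.wordProd_singleton, hx] at h7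
    have h8 := h2.eq
    rw [h1] at h8
    simp only [List.length_append, List.length_singleton] at h7
    unfold IsShort at h3
    have h9 : B.d i x = -1 := by rw [d]; omega
    exact asc_append_iff.2 ⟨ih h2 (by rw [h1, B.act_val (by omega)]), h9⟩

end BitModel

/-! ### Paths from the identity coset and their uniqueness. -/

variable {D : ParabolicDatum}

/-- There is a path from `∅` to `x` with weight `ω`. -/
def Reach (D : ParabolicDatum) (ω : List (Fin D.rank)) (x : D.CosetRep) : Prop :=
  ∃ S : Quiver.Path D.vac x, D.pathWord S = ω

lemma length_pathWord {x y : D.CosetRep} (S : Quiver.Path x y) :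
    (D.pathWord S).length = S.length := by
  induction S with
  | nil => rfl
  | cons p e ih => simp [pathWord, ih]

lemma reach_nil_iff {x : D.CosetRep} : D.Reach [] x ↔ x = D.vac := by
  constructor
  · rintro ⟨S, hS⟩
    cases S with
    | nil => rfl
    | cons p e => simp [pathWord] at hS
  · rintro rfl
    exact ⟨.nil, rfl⟩

lemma exists_of_pathWord_eq_append {ω : List (Fin D.rank)} {i : Fin D.rank} {x : D.CosetRep}
    {S : Quiver.Path D.vac x} (hS : D.pathWord S = ω ++ [i]) :
    ∃ (y : D.CosetRep) (S' : Quiver.Path D.vac y) (h : D.IsEdge y x i),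
      D.pathWord S' = ω ∧ S = S'.cons ⟨i, h⟩ := by
  cases S with
  | nil => simp [pathWord] at hS
  | cons p e =>
    obtain ⟨h1, h2⟩ := List.append_inj' (hS : _ ++ _ = _) rfl
    obtain rfl : e.1 = i := by simpa using h2
    exact ⟨_, p, e.2, h1, rfl⟩

namespace BitModel

open BitMove

variable {D : ParabolicDatum} (B : BitModel D)

lemma reach_append_iff {ω : List (Fin D.rank)} {i : Fin D.rank} {x : D.CosetRep} :
    D.Reach (ω ++ [i]) x ↔ B.d i x ≠ 0 ∧ (D.Reach ω x ∨ D.Reach ω (B.act i x)) := by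
  constructor
  · rintro ⟨S, hS⟩
    obtain ⟨y, S', h, hS', -⟩ := exists_of_pathWord_eq_append hS
    obtain ⟨h1, rfl | rfl⟩ := B.isEdge_iff.1 h
    · exact ⟨h1, .inl ⟨S', hS'⟩⟩
    · rw [d_act_self, act_act]
      exact ⟨by omega, .inr ⟨S', hS'⟩⟩
  · rintro ⟨h1, ⟨S, hS⟩ | ⟨S, hS⟩⟩
    · exact ⟨S.cons ⟨i, B.isEdge_iff.2 ⟨h1, .inl rfl⟩⟩, by simp [pathWord, hS]⟩
    · exact ⟨S.cons ⟨i, B.isEdge_iff.2 ⟨by rw [d_act_self]; omega, .inr (by simp)⟩⟩,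
        by simp [pathWord, hS]⟩

/-- A path is at least as long as its end point, with equality only for ascending paths. -/
lemma length_le_of_path {x : D.CosetRep} (S : Quiver.Path D.vac x) :
    D.cs.length x.1 ≤ S.length ∧ (D.cs.length x.1 = S.length → B.Asc (D.pathWord S) x) := by
  induction S with
  | nil => exact ⟨by simp [vac], fun _ ↦ .nil⟩
  | @cons y z p e ih =>
    have h1 := B.d_cases e.1 y
    rw [Quiver.Path.length_cons, pathWord]
    obtain ⟨h2, h3 | h3⟩ := B.isEdge_iff.1 e.2
    · subst h3
      exact ⟨by omega, by omega⟩
    · have h4 := B.length_act e.1 y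
      rw [← h3] at h4
      refine ⟨by omega, fun h ↦ ?_⟩
      have h5 := (ih.2 (by omega)).snoc e.1 (by omega)
      rwa [← h3] at h5

lemma exists_path_of_asc {ω : List (Fin D.rank)} {x : D.CosetRep} (h : B.Asc ω x) :
    D.Reach ω x := by
  induction h with
  | nil => exact reach_nil_iff.2 rfl
  | snoc i h hi ih =>
    rw [B.reach_append_iff, act_act, d_act_self]
    exact ⟨by omega, .inr ih⟩

/-- An ascending word yields a path with as many steps as the length of `x`, so a shortest path is
no longer and has no loop or descent to waste. -/
lemma asc_of_isReducedPath {x : D.CosetRep} {S : Quiver.Path D.vac x} (hS : D.IsReducedPath S) :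
    B.Asc (D.pathWord S) x := by
  refine (B.length_le_of_path S).2 (le_antisymm (B.length_le_of_path S).1 ?_)
  obtain ⟨ω, hω⟩ := B.exists_asc x
  obtain ⟨S', hS'⟩ := B.exists_path_of_asc hω
  have := hS S'
  rwa [← length_pathWord S', hS', hω.length_eq] at this

/-- Every zero of the sequence of `μ` is either constant among the end points of the paths with
weight `ω`, or always complementary to a fixed later entry. -/
lemma Asc.bits_linked {B : BitModel D} {ω : List (Fin D.rank)} {μ : D.CosetRep} (h : B.Asc ω μ)
    (p : ℕ) (hp : B.bits μ.1 p = 0) : (∀ y, D.Reach ω y → B.bits y.1 p = 0) ∨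
      ∃ r, p < r ∧ B.bits μ.1 r = 1 ∧ ∀ y, D.Reach ω y → B.bits y.1 p + B.bits y.1 r = 1 := by
  induction h generalizing p with
  | nil =>
    left
    intro y hy
    rwa [reach_nil_iff.1 hy]
  | @snoc ω μ i h hi ih =>
    have hpair : ∀ y, B.d i y = (B.move i).pair (B.bits y.1) := fun _ ↦ rfl
    have hbits : ∀ y q, B.bits (B.act i y).1 q = B.bits y.1 q + B.d i y * (B.move i).root q :=
      fun y q ↦ by rw [bits_act]; rfl
    -- it suffices to consider the sources of the last step
    have key : ∀ q, (B.move i).root q = 0 → ∀ r, (B.move i).root r = 0 →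
        (∀ y, D.Reach ω y → B.d i y ≠ 0 → B.bits y.1 q + B.bits y.1 r = 1) →
        ∀ y, D.Reach (ω ++ [i]) y → B.bits y.1 q + B.bits y.1 r = 1 := by
      intro q hq r hr H y hy
      rw [B.reach_append_iff] at hy
      rcases hy with ⟨h1, h2 | h2⟩
      · exact H y h2 h1
      · have := H _ h2 (by rw [d_act_self]; omega)
        rwa [hbits, hbits, hq, hr, mul_zero, add_zero, add_zero] at this
    have key' : ∀ q, (B.move i).root q = 0 →
        (∀ y, D.Reach ω y → B.d i y ≠ 0 → B.bits y.1 q = 0) →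
        ∀ y, D.Reach (ω ++ [i]) y → B.bits y.1 q = 0 := by
      intro q hq H y hy
      rw [B.reach_append_iff] at hy
      rcases hy with ⟨h1, h2 | h2⟩
      · exact H y h2 h1
      · have := H _ h2 (by rw [d_act_self]; omega)
        rwa [hbits, hq, mul_zero, add_zero] at this
    have hb := B.isBits_bits μ.1
    rw [hbits, hi, one_mul] at hp
    simp only [hbits, hi, one_mul]
    cases hm : B.move i with
    | swap k =>
      simp only [hm, pair, root] at hpair hbits hp key key' ⊢
      have hk := hb k; have hk1 := hb (k + 1)
      have hμ := hpair μ
      have hs : ∀ q, q ≠ k → q ≠ k + 1 →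
          (Pi.single (k + 1) (1 : ℤ) - Pi.single k 1 : ℕ → ℤ) q = 0 := by
        intro q h1 h2; simp [h1, h2]
      -- The new zero at `k` is linked to `k + 1`: an edge labelled `i` exists only where these two
      -- entries differ.
      by_cases hpk : p = k
      · subst hpk
        refine .inr ⟨p + 1, by omega, by simp; omega, fun y hy ↦ ?_⟩
        have h1 := ((B.reach_append_iff).1 hy).1
        have h2 := hpair y
        have h3 := B.isBits_bits y.1 p; have h4 := B.isBits_bits y.1 (p + 1)
        omega
      · by_cases hpk1 : p = k + 1
        · subst hpk1
          simp at hp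
          omega
        rw [hs p hpk hpk1, add_zero] at hp
        rcases ih p hp with h1 | ⟨r, hr, hr1, h1⟩
        · exact .inl (key' p (hs p hpk hpk1) fun y hy _ ↦ h1 y hy)
        -- The old partner `k` of `p` is displaced. At the relevant sources the entries `k` and `k +
        -- 1` are complementary, so the entry at `p` agrees with that at `k + 1`, an old zero of
        -- `μ`, and inherits its constraint: two cups are joined.
        · by_cases hrk : r = k
          · subst hrk
            have hlink : ∀ y, D.Reach ω y → B.d i y ≠ 0 → B.bits y.1 p = B.bits y.1 (r + 1) := by
              intro y hy hd
              have h2 := hpair y; have h3 := h1 y hy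
              have h4 := B.isBits_bits y.1 r; have h5 := B.isBits_bits y.1 (r + 1)
              omega
            rcases ih (r + 1) (by omega) with h2 | ⟨r', hr', hr1', h2⟩
            · exact .inl (key' p (hs p hpk hpk1) fun y hy hd ↦ by rw [hlink y hy hd, h2 y hy])
            · refine .inr ⟨r', by omega, ?_, key p (hs p hpk hpk1) r' (hs r' (by omega) (by omega))
                fun y hy hd ↦ by rw [hlink y hy hd, h2 y hy]⟩
              rw [hs r' (by omega) (by omega), add_zero, hr1']
          · have hrk1 : r ≠ k + 1 := by rintro rfl; omega
            refine .inr ⟨r, hr, by rw [hs r hrk hrk1, add_zero, hr1],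
              key p (hs p hpk hpk1) r (hs r hrk hrk1) fun y hy _ ↦ h1 y hy⟩
    | flip =>
      simp only [hm, pair, root] at hpair hbits hp key key' ⊢
      have hμ := hpair μ
      have h0 := hb 0
      -- An ascending flip turns entry 0 into a one, so every remaining zero, and its later partner,
      -- is untouched by the move.
      by_cases hp0 : p = 0
      · subst hp0; simp at hp; omega
      have hs : ∀ q, p ≤ q → (Pi.single 0 (1 : ℤ) : ℕ → ℤ) q = 0 := by
        intro q hq; simp [show q ≠ 0 by omega]
      rw [hs p le_rfl, add_zero] at hp
      rcases ih p hp with h1 | ⟨r, hr, hr1, h1⟩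
      · exact .inl (key' p (hs p le_rfl) fun y hy _ ↦ h1 y hy)
      · exact .inr ⟨r, hr, by rw [hs r hr.le, add_zero, hr1],
          key p (hs p le_rfl) r (hs r hr.le) fun y hy _ ↦ h1 y hy⟩
    | flipPair =>
      simp only [hm, pair, root] at hpair hbits hp key key' ⊢
      have hμ := hpair μ
      have h0 := hb 0; have h1 := hb 1
      by_cases hp0 : p = 0
      · subst hp0; simp at hp; omega
      by_cases hp1 : p = 1
      · subst hp1; simp at hp; omega
      have hs : ∀ q, p ≤ q → (Pi.single 0 (1 : ℤ) + Pi.single 1 1 : ℕ → ℤ) q = 0 := by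
        intro q hq; simp [show q ≠ 0 by omega, show q ≠ 1 by omega]
      rw [hs p le_rfl, add_zero] at hp
      rcases ih p hp with h1 | ⟨r, hr, hr1, h1⟩
      · exact .inl (key' p (hs p le_rfl) fun y hy _ ↦ h1 y hy)
      · exact .inr ⟨r, hr, by rw [hs r hr.le, add_zero, hr1],
          key p (hs p le_rfl) r (hs r hr.le) fun y hy _ ↦ h1 y hy⟩

/-- The two end points would differ by a nonzero multiple of the root. At a suitable zero of `μ` in
the support of the root, the constraint of `Asc.bits_linked` involves no other entry that changes,
so it cannot hold for both. -/
lemma Asc.not_reach_act {B : BitModel D} {ω : List (Fin D.rank)} {μ : D.CosetRep} (h : B.Asc ω μ)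
    {i : Fin D.rank} (hi : B.d i μ = 1) {x : D.CosetRep} (hx : B.d i x ≠ 0) (h1 : D.Reach ω x) :
    ¬ D.Reach ω (B.act i x) := by
  intro h2
  have hpair : ∀ y, B.d i y = (B.move i).pair (B.bits y.1) := fun _ ↦ rfl
  have hbits : ∀ y q, B.bits (B.act i y).1 q = B.bits y.1 q + B.d i y * (B.move i).root q :=
    fun y q ↦ by rw [bits_act]; rfl
  have hb := B.isBits_bits μ.1
  have hμ := hpair μ
  -- a position changed by the move, at which the sequence of `μ` vanishes
  have main : ∀ p, B.bits μ.1 p = 0 → (B.move i).root p ≠ 0 →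
      (∀ r, p < r → B.bits μ.1 r = 1 → (B.move i).root r = 0) → False := by
    intro p hp hr H
    rcases h.bits_linked p hp with h3 | ⟨r, hpr, hr1, h3⟩
    · have h4 := h3 _ h1; have h5 := h3 _ h2
      rw [hbits, h4, zero_add] at h5
      exact mul_ne_zero hx hr h5
    · have h4 := h3 _ h1; have h5 := h3 _ h2
      rw [hbits, hbits, H r hpr hr1, mul_zero, add_zero] at h5
      exact mul_ne_zero hx hr (by linarith)
  cases hm : B.move i with
  | swap k =>
    simp only [hm, pair, root] at hμ main
    have hk := hb k; have hk1 := hb (k + 1)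
    exact main (k + 1) (by omega) (by simp) fun r h3 _ ↦ by
      simp [show r ≠ k + 1 by omega, show r ≠ k by omega]
  | flip =>
    simp only [hm, pair, root] at hμ main
    exact main 0 (by omega) (by simp) fun r h3 _ ↦ by simp [h3.ne']
  | flipPair =>
    simp only [hm, pair, root] at hμ main
    have h0 := hb 0; have h1 := hb 1
    refine main 0 (by omega) (by simp) fun r h3 h4 ↦ ?_
    have : r ≠ 1 := by rintro rfl; omega
    simp [h3.ne', this]

/-- There is at most one path with given reduced weight and given end point. -/
lemma Asc.path_unique {B : BitModel D} {ω : List (Fin D.rank)} {μ : D.CosetRep} (h : B.Asc ω μ)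
    {x : D.CosetRep} {S S' : Quiver.Path D.vac x} (hS : D.pathWord S = ω)
    (hS' : D.pathWord S' = ω) : S = S' := by
  induction h generalizing x with
  | nil =>
    cases S with
    | nil =>
      cases S' with
      | nil => rfl
      | cons p e => simp [pathWord] at hS'
    | cons p e => simp [pathWord] at hS
  | @snoc ω μ i h hi ih =>
    obtain ⟨y, T, hT, hTω, rfl⟩ := exists_of_pathWord_eq_append hS
    obtain ⟨y', T', hT', hTω', rfl⟩ := exists_of_pathWord_eq_append hS'
    obtain ⟨h1, h2⟩ := B.isEdge_iff.1 hT
    obtain ⟨h1', h2'⟩ := B.isEdge_iff.1 hT'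
    by_cases hy : y = y'
    · subst hy
      rw [ih hTω hTω']
    · exfalso
      have : y' = B.act i y := by
        rcases h2 with h2 | h2 <;> rcases h2' with h2' | h2'
        · exact absurd (h2.symm.trans h2') hy
        · rw [← h2, h2', act_act]
        · rw [← h2', h2]
        · rw [h2] at h2'
          exact absurd (by simpa using congrArg (B.act i) h2') hy
      subst this
      exact h.not_reach_act hi h1 ⟨T, hTω⟩ ⟨T', hTω'⟩

end BitModel

end ParabolicDatum

/-! ### The Temperley--Lieb relations in terms of single edges. -/

namespace ParabolicDatum

open LaurentPolynomial (T)

variable {D : ParabolicDatum}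

namespace BitModel

variable (B : BitModel D)

/-- The end of the edge labelled `i` from `x`, which is a loop if `ε` is false. -/
noncomputable def step (ε : Bool) (i : Fin D.rank) (x : D.CosetRep) : D.CosetRep :=
  if ε then B.act i x else x

lemma d_step_comm {i j : Fin D.rank} (h : D.coxMatrix i j = 2) (ε : Bool) (x : D.CosetRep) :
    B.d i (B.step ε j x) = B.d i x := by
  cases ε <;> simp [step, B.d_act_comm h]

lemma step_comm {i j : Fin D.rank} (h : D.coxMatrix i j = 2) (ε δ : Bool) (x : D.CosetRep) :
    B.step ε i (B.step δ j x) = B.step δ j (B.step ε i x) := by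
  cases ε <;> cases δ <;> simp [step, B.act_comm h]

lemma isEdge_step {ε : Bool} {i : Fin D.rank} {x : D.CosetRep} (h : B.d i x ≠ 0) :
    D.IsEdge x (B.step ε i x) i := by
  rw [B.isEdge_iff]
  cases ε <;> simp [step, h]

lemma isEdge_iff_step {i : Fin D.rank} {x y : D.CosetRep} :
    D.IsEdge x y i ↔ B.d i x ≠ 0 ∧ ∃ ε, y = B.step ε i x := by
  rw [B.isEdge_iff]
  simp [step]

include B in
lemma isEdge_symm {i : Fin D.rank} {x y : D.CosetRep} (h : D.IsEdge x y i) : D.IsEdge y x i := by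
  rw [B.isEdge_iff] at h ⊢
  rcases h with ⟨h, rfl | rfl⟩ <;> simp [h]

include B in
lemma isEdge_trans {i : Fin D.rank} {x y z : D.CosetRep} (h : D.IsEdge x y i)
    (h' : D.IsEdge y z i) : D.IsEdge x z i := by
  rw [B.isEdge_iff] at h h' ⊢
  rcases h with ⟨h, rfl | rfl⟩ <;> rcases h' with ⟨h', rfl | rfl⟩ <;> simp [h]

end BitModel

/-- A family of elements of a ring, indexed by the vertices and edges of the extended Bruhat
graph, which multiplies like paths. -/
structure EdgeFamily (D : ParabolicDatum) [Fintype D.CosetRep] [DecidableEq D.CosetRep]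
    (A : Type*) [Ring A] where
  vert : D.CosetRep → A
  edge : Fin D.rank → D.CosetRep → D.CosetRep → A
  vert_mul_vert : ∀ x y, vert x * vert y = if x = y then vert x else 0
  sum_vert : ∑ x, vert x = 1
  vert_mul_edge : ∀ i x y z, vert x * edge i y z = if x = y then edge i y z else 0
  edge_mul_vert : ∀ i x y z, edge i y z * vert x = if z = x then edge i y z else 0
  edge_eq_zero : ∀ i x y, ¬ D.IsEdge x y i → edge i x y = 0

namespace EdgeFamily

variable [Fintype D.CosetRep] [DecidableEq D.CosetRep] {A : Type*} [Ring A] (F : D.EdgeFamily A)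
  (B : BitModel D)

/-- The generator `E_i`, as a sum over the edges. -/
def gen (i : Fin D.rank) : A := ∑ x, ∑ y, F.edge i x y

lemma vert_mul_gen (i : Fin D.rank) (x : D.CosetRep) :
    F.vert x * F.gen i = ∑ y, F.edge i x y := by
  simp only [gen, Finset.mul_sum, F.vert_mul_edge]
  rw [Finset.sum_eq_single x] <;> simp +contextual [eq_comm]

lemma vert_mul_gen_mul_vert (i : Fin D.rank) (x y : D.CosetRep) :
    F.vert x * F.gen i * F.vert y = F.edge i x y := by
  simp [vert_mul_gen, Finset.sum_mul, F.edge_mul_vert]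

lemma edge_mul_gen (i j : Fin D.rank) (x y : D.CosetRep) :
    F.edge i x y * F.gen j = ∑ z, F.edge i x y * F.edge j y z := by
  have h1 := F.edge_mul_vert i y x y
  rw [if_pos rfl] at h1
  rw [← h1, mul_assoc, F.vert_mul_gen, Finset.mul_sum]
  simp only [mul_assoc, F.vert_mul_edge, if_true]

lemma eq_of_vert_mul_mul_vert {a b : A}
    (h : ∀ x y, F.vert x * a * F.vert y = F.vert x * b * F.vert y) : a = b := by
  have h1 : ∀ c : A, c = ∑ x, ∑ y, F.vert x * c * F.vert y := by
    intro c
    simp_rw [← Finset.mul_sum, F.sum_vert, mul_one, ← Finset.sum_mul, F.sum_vert, one_mul]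
  rw [h1 a, h1 b]
  simp only [h]

lemma vert_mul_gen_mul_gen_mul_vert (i j : Fin D.rank) (x z : D.CosetRep) :
    F.vert x * (F.gen i * F.gen j) * F.vert z = ∑ y, F.edge i x y * F.edge j y z := by
  rw [← mul_assoc, F.vert_mul_gen, Finset.sum_mul, Finset.sum_mul]
  refine Finset.sum_congr rfl fun y _ ↦ ?_
  simp [edge_mul_gen, Finset.sum_mul, mul_assoc, F.edge_mul_vert]

lemma vert_mul_gen_mul_gen_mul_gen_mul_vert (i j k : Fin D.rank) (x z : D.CosetRep) :
    F.vert x * (F.gen i * F.gen j * F.gen k) * F.vert z =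
      ∑ y, ∑ w, F.edge i x y * F.edge j y w * F.edge k w z := by
  rw [← mul_assoc, ← mul_assoc, F.vert_mul_gen, Finset.sum_mul, Finset.sum_mul, Finset.sum_mul]
  refine Finset.sum_congr rfl fun y _ ↦ ?_
  rw [edge_mul_gen, Finset.sum_mul, Finset.sum_mul]
  refine Finset.sum_congr rfl fun w _ ↦ ?_
  rw [mul_assoc, mul_assoc, ← mul_assoc (F.edge j y w), edge_mul_gen, Finset.sum_mul]
  simp [mul_assoc, F.edge_mul_vert]

include B in
-- Crossing a non-loop labelled `j` makes the pairing with `i` vanish, so no edge labelled `i` can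
-- follow.
lemma sum_edge_mul_edge_of_adj {i j : Fin D.rank} (h : D.Adj i j) (x z : D.CosetRep) :
    ∑ y, ∑ w, F.edge i x y * F.edge j y w * F.edge i w z =
      ∑ y, F.edge i x y * F.edge j y y * F.edge i y z := by
  refine Finset.sum_congr rfl fun y _ ↦ Finset.sum_eq_single y (fun w _ hw ↦ ?_) (by simp)
  by_cases h1 : D.IsEdge x y i
  swap
  · rw [F.edge_eq_zero _ _ _ h1, zero_mul, zero_mul]
  by_cases h2 : D.IsEdge y w j
  swap
  · rw [F.edge_eq_zero _ _ _ h2, mul_zero, zero_mul]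
  rw [F.edge_eq_zero i w z, mul_zero]
  have h3 := (B.isEdge_iff.1 (B.isEdge_symm h1)).1
  obtain ⟨h4, h5 | rfl⟩ := B.isEdge_iff.1 h2
  · exact absurd h5 hw
  · rw [B.isEdge_iff, B.d_act_eq_zero_of_adj h h3 h4]
    simp

/-- The pairings with `j` at `x` and `x s_i` differ by `d i x`, which is 1 or -1, so exactly one of
them is nonzero. Hence the global relation for `m = 3` amounts to a relation on edges. For `m = 4`
with `i` short both are nonzero, and the relation has to be imposed at each vertex. -/
lemma sum_edge_mul_edge_of_three {i j : Fin D.rank} (h : D.coxMatrix i j = 3)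
    {x : D.CosetRep} (hx : B.d i x ≠ 0) : ∃ y, D.IsEdge x y i ∧ B.d j y ≠ 0 ∧
    ∀ z, ∑ y, F.edge i x y * F.edge j y y * F.edge i y z =
      F.edge i x y * F.edge j y y * F.edge i y z := by
  have h' : D.Adj j i := .inl (by rw [D.coxMatrix.symmetric, h])
  have h1 := B.d_act_of_adj h' x
  have h2 := B.d_cases j (B.act i x)
  have h3 := B.d_cases j x
  have h4 := B.d_cases i x
  have key : ∀ y, D.IsEdge x y i → B.d j (B.act i y) = 0 →
      ∀ z, ∑ y, F.edge i x y * F.edge j y y * F.edge i y z =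
      F.edge i x y * F.edge j y y * F.edge i y z := by
    intro y hy h0 z
    refine Finset.sum_eq_single y (fun w _ hw ↦ ?_) (by simp)
    by_cases h1 : D.IsEdge x w i
    swap
    · rw [F.edge_eq_zero _ _ _ h1, zero_mul, zero_mul]
    obtain ⟨-, h5 | rfl⟩ := B.isEdge_iff.1 (B.isEdge_trans (B.isEdge_symm hy) h1)
    · exact absurd h5 hw
    · rw [F.edge_eq_zero j, mul_zero, zero_mul]
      rw [B.isEdge_iff, h0]
      simp
  by_cases h5 : B.d j x = 0
  · refine ⟨B.act i x, B.isEdge_iff.2 ⟨hx, .inr rfl⟩, by omega, key _ ?_ ?_⟩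
    · exact B.isEdge_iff.2 ⟨hx, .inr rfl⟩
    · rw [B.act_act, h5]
  · refine ⟨x, B.isEdge_iff.2 ⟨hx, .inl rfl⟩, h5, key _ ?_ (by omega)⟩
    exact B.isEdge_iff.2 ⟨hx, .inl rfl⟩

/-- An edge labelled `j` preserves the pairing with `i`, so its sign at the end point tells whether
the edge labelled `i` was a loop. This determines the midpoint. -/
lemma sum_edge_mul_edge_of_two {i j : Fin D.rank} (h : D.coxMatrix i j = 2) (ε δ : Bool)
    (x : D.CosetRep) : ∑ y, F.edge i x y * F.edge j y (B.step δ j (B.step ε i x)) =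
      F.edge i x (B.step ε i x) * F.edge j (B.step ε i x) (B.step δ j (B.step ε i x)) := by
  refine Finset.sum_eq_single _ (fun y _ hy ↦ ?_) (by simp)
  by_cases h1 : D.IsEdge x y i
  swap
  · rw [F.edge_eq_zero _ _ _ h1, zero_mul]
  rw [F.edge_eq_zero j, mul_zero]
  intro h2
  obtain ⟨hd, ε', rfl⟩ := B.isEdge_iff_step.1 h1
  obtain ⟨hd', δ', h3⟩ := B.isEdge_iff_step.1 h2
  have h' : D.coxMatrix j i = 2 := by rw [D.coxMatrix.symmetric, h]
  have hij : ∀ z, B.d i (B.act j z) = B.d i z := fun z ↦ B.d_act_comm h z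
  have hi : ∀ z, B.d i (B.step ε i z) = if ε then -B.d i z else B.d i z := by
    intro z; cases ε <;> simp [BitModel.step]
  have hi' : ∀ z, B.d i (B.step ε' i z) = if ε' then -B.d i z else B.d i z := by
    intro z; cases ε' <;> simp [BitModel.step]
  have h4 := congrArg (B.d i) h3
  rw [B.d_step_comm h, B.d_step_comm h, hi, hi'] at h4
  apply hy
  have : ε = ε' := by
    cases ε <;> cases ε' <;> simp at h4 ⊢ <;> omega
  rw [this]

include B in
lemma gen_mul_gen_comm {i j : Fin D.rank} (h : D.coxMatrix i j = 2)
    (hF : ∀ (ε δ : Bool) x, B.d i x ≠ 0 → B.d j x ≠ 0 →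
      F.edge i x (B.step ε i x) * F.edge j (B.step ε i x) (B.step δ j (B.step ε i x)) =
        F.edge j x (B.step δ j x) * F.edge i (B.step δ j x) (B.step ε i (B.step δ j x))) :
    F.gen i * F.gen j = F.gen j * F.gen i := by
  have h' : D.coxMatrix j i = 2 := by rw [D.coxMatrix.symmetric, h]
  apply F.eq_of_vert_mul_mul_vert
  intro x z
  rw [F.vert_mul_gen_mul_gen_mul_vert, F.vert_mul_gen_mul_gen_mul_vert]
  have hzero : ∀ {i j : Fin D.rank}, D.coxMatrix i j = 2 →
      (¬ ∃ ε δ, B.d i x ≠ 0 ∧ B.d j x ≠ 0 ∧ z = B.step δ j (B.step ε i x)) →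
      ∑ y, F.edge i x y * F.edge j y z = 0 := by
    intro i j h hz
    have h' : D.coxMatrix j i = 2 := by rw [D.coxMatrix.symmetric, h]
    refine Finset.sum_eq_zero fun y _ ↦ ?_
    by_contra hne
    have h1 : D.IsEdge x y i := by
      by_contra h1; exact hne (by rw [F.edge_eq_zero _ _ _ h1, zero_mul])
    have h2 : D.IsEdge y z j := by
      by_contra h2; exact hne (by rw [F.edge_eq_zero _ _ _ h2, mul_zero])
    obtain ⟨hd, ε, rfl⟩ := B.isEdge_iff_step.1 h1
    obtain ⟨hd', δ, rfl⟩ := B.isEdge_iff_step.1 h2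
    exact hz ⟨ε, δ, hd, by rwa [B.d_step_comm h'] at hd', rfl⟩
  by_cases hz : ∃ ε δ, B.d i x ≠ 0 ∧ B.d j x ≠ 0 ∧ z = B.step δ j (B.step ε i x)
  · obtain ⟨ε, δ, hi, hj, rfl⟩ := hz
    rw [F.sum_edge_mul_edge_of_two B h, hF ε δ x hi hj, B.step_comm h',
      F.sum_edge_mul_edge_of_two B h']
  · rw [hzero h hz, hzero h']
    rintro ⟨ε, δ, h1, h2, h3⟩
    exact hz ⟨δ, ε, h2, h1, by rw [h3, B.step_comm h]⟩

include B in
lemma gen_mul_gen_mul_gen {i j : Fin D.rank} (h : D.coxMatrix i j = 3)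
    (hF : ∀ x y z, B.d j x ≠ 0 → D.IsEdge x y i → D.IsEdge x z i →
      F.edge i y x * F.edge j x x * F.edge i x z = F.edge i y z) :
    F.gen i * F.gen j * F.gen i = F.gen i := by
  apply F.eq_of_vert_mul_mul_vert
  intro x z
  rw [F.vert_mul_gen_mul_gen_mul_gen_mul_vert, F.vert_mul_gen_mul_vert,
    F.sum_edge_mul_edge_of_adj B (.inl h)]
  by_cases hx : B.d i x = 0
  · have h1 : ∀ y, F.edge i x y = 0 := fun y ↦ F.edge_eq_zero _ _ _ (by
      rw [B.isEdge_iff, hx]; simp)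
    simp [h1]
  · obtain ⟨y, hy, hj, h1⟩ := F.sum_edge_mul_edge_of_three B h hx
    rw [h1]
    by_cases hz : D.IsEdge y z i
    · exact hF y x z hj (B.isEdge_symm hy) hz
    · rw [F.edge_eq_zero i y z hz, mul_zero, F.edge_eq_zero]
      exact fun h2 ↦ hz (B.isEdge_trans (B.isEdge_symm hy) h2)

variable [Algebra (LaurentPolynomial ℤ) A]

/-- The relations of the Temperley--Lieb algebra, in terms of single edges. -/
structure IsTL : Prop where
  square : ∀ i x y z, D.IsEdge x y i → D.IsEdge x z i →
    F.edge i y x * F.edge i x z = (T (B.d i x) : LaurentPolynomial ℤ) • F.edge i y z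
  comm : ∀ i j, D.coxMatrix i j = 2 → ∀ (ε δ : Bool) x, B.d i x ≠ 0 → B.d j x ≠ 0 →
    F.edge i x (B.step ε i x) * F.edge j (B.step ε i x) (B.step δ j (B.step ε i x)) =
      F.edge j x (B.step δ j x) * F.edge i (B.step δ j x) (B.step ε i (B.step δ j x))
  adj : ∀ i j, D.Adj i j → ∀ x y z, B.d j x ≠ 0 → D.IsEdge x y i → D.IsEdge x z i →
    F.edge i y x * F.edge j x x * F.edge i x z = F.edge i y z

variable {F B}

/-- The images of the generators. -/
def genMap (F : D.EdgeFamily A) : D.TLGen → A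
  | .idem x => F.vert x
  | .cupcap i => F.gen i

lemma IsTL.lift_rel (hF : F.IsTL B) ⦃a b : D.FreeTL⦄ (h : D.TLRel a b) :
    FreeAlgebra.lift (LaurentPolynomial ℤ) F.genMap a =
      FreeAlgebra.lift (LaurentPolynomial ℤ) F.genMap b := by
  have hone : ∀ x, FreeAlgebra.lift (LaurentPolynomial ℤ) F.genMap (D.freeOne x) = F.vert x :=
    fun x ↦ FreeAlgebra.lift_ι_apply ..
  have hE : ∀ i, FreeAlgebra.lift (LaurentPolynomial ℤ) F.genMap (D.freeE i) = F.gen i :=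
    fun x ↦ FreeAlgebra.lift_ι_apply ..
  cases h with
  | one_eq_sum s hs =>
    obtain rfl : s = Finset.univ := Finset.eq_univ_of_forall hs
    simp [hone, F.sum_vert]
  | one_mul_self x => simp [hone, F.vert_mul_vert]
  | one_mul_ne x y hxy => simp [hone, F.vert_mul_vert, hxy]
  | not_edge x y i h => simp [hone, hE, F.vert_mul_gen_mul_vert, F.edge_eq_zero i x y h]
  | square i x y z hy hz =>
    have h0 := (B.isEdge_iff.1 hy).1
    rw [B.length_mul_simple h0, add_sub_cancel_left]
    simp only [map_mul, map_smul, hone, hE, F.vert_mul_gen_mul_vert, ← hF.square i x y z hy hz]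
    rw [mul_assoc, ← F.vert_mul_gen_mul_vert i x z, ← F.vert_mul_gen_mul_vert i y x]
    have h1 : F.vert x * F.vert x = F.vert x := by simp [F.vert_mul_vert]
    simp only [mul_assoc]
    rw [← mul_assoc (F.vert x) (F.vert x), h1]
  | comm i j h => simp [hE, F.gen_mul_gen_comm B h (hF.comm i j h)]
  | three i j h => simp [hE, F.gen_mul_gen_mul_gen B h (hF.adj i j (.inl h))]
  | four i j h hi x y z hj hy hz =>
    rw [B.isMinimal_mul_simple_iff] at hj
    simp only [map_mul, hone, hE, F.vert_mul_gen_mul_vert]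
    rw [← hF.adj i j (.inr ⟨h, hi⟩) x y z hj hy hz]
    have h1 : F.vert x * F.vert x = F.vert x := by simp [F.vert_mul_vert]
    rw [← F.vert_mul_gen_mul_vert j x x, ← F.vert_mul_gen_mul_vert i x z,
      ← F.vert_mul_gen_mul_vert i y x]
    simp only [mul_assoc]
    rw [← mul_assoc (F.vert x) (F.vert x), h1, ← mul_assoc (F.vert x) (F.vert x), h1]

/-- The algebra homomorphism given by a family satisfying the Temperley--Lieb relations. -/
noncomputable def IsTL.hom (hF : F.IsTL B) : D.TL →ₐ[LaurentPolynomial ℤ] A :=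
  RingQuot.liftAlgHom (LaurentPolynomial ℤ)
    ⟨FreeAlgebra.lift (LaurentPolynomial ℤ) F.genMap, hF.lift_rel⟩

lemma IsTL.hom_one (hF : F.IsTL B) (x : D.CosetRep) : hF.hom (D.one x) = F.vert x := by
  rw [hom, one, RingQuot.liftAlgHom_mkAlgHom_apply]
  exact FreeAlgebra.lift_ι_apply ..

lemma IsTL.hom_E (hF : F.IsTL B) (i : Fin D.rank) : hF.hom (D.E i) = F.gen i := by
  rw [hom, E, RingQuot.liftAlgHom_mkAlgHom_apply]
  exact FreeAlgebra.lift_ι_apply ..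

lemma IsTL.hom_edge (hF : F.IsTL B) (i : Fin D.rank) (x y : D.CosetRep) :
    hF.hom (D.one x * D.E i * D.one y) = F.edge i x y := by
  rw [map_mul, map_mul, hF.hom_one, hF.hom_one, hF.hom_E, F.vert_mul_gen_mul_vert]

end EdgeFamily

section Relations

open Classical in
lemma one_mul_one (x y : D.CosetRep) : D.one x * D.one y = if x = y then D.one x else 0 := by
  unfold one
  rw [← map_mul]
  split_ifs with h
  · subst h
    exact RingQuot.mkAlgHom_rel _ (.one_mul_self x)
  · rw [RingQuot.mkAlgHom_rel _ (.one_mul_ne x y h), map_zero]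

@[simp] lemma one_mul_one_self (x : D.CosetRep) : D.one x * D.one x = D.one x := by
  simp [one_mul_one]

lemma one_mul_one_of_ne {x y : D.CosetRep} (h : x ≠ y) : D.one x * D.one y = 0 := by
  simp [one_mul_one, h]

lemma sum_one [Fintype D.CosetRep] : ∑ x, D.one x = 1 := by
  unfold one
  rw [← map_sum, ← RingQuot.mkAlgHom_rel _ (.one_eq_sum Finset.univ Finset.mem_univ), map_one]

lemma E_mul_E_comm {i j : Fin D.rank} (h : D.coxMatrix i j = 2) : D.E i * D.E j = D.E j * D.E i := by
  unfold E
  rw [← map_mul, RingQuot.mkAlgHom_rel _ (.comm i j h), map_mul]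

lemma E_mul_E_mul_E {i j : Fin D.rank} (h : D.coxMatrix i j = 3) :
    D.E i * D.E j * D.E i = D.E i := by
  unfold E
  rw [← map_mul, ← map_mul, RingQuot.mkAlgHom_rel _ (.three i j h)]

variable [Fintype D.CosetRep] [DecidableEq D.CosetRep]

/-- The edges of the extended Bruhat graph in the Temperley--Lieb algebra. -/
noncomputable def tlFamily (D : ParabolicDatum) [Fintype D.CosetRep] [DecidableEq D.CosetRep] :
    D.EdgeFamily D.TL where
  vert := D.one
  edge i x y := D.one x * D.E i * D.one y
  vert_mul_vert x y := by rw [one_mul_one]; congr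
  sum_vert := sum_one
  vert_mul_edge i x y z := by
    rw [← mul_assoc, ← mul_assoc]
    split_ifs with h
    · subst h; rw [one_mul_one_self]
    · rw [one_mul_one_of_ne h, zero_mul, zero_mul]
  edge_mul_vert i x y z := by
    rw [mul_assoc]
    split_ifs with h
    · subst h; rw [one_mul_one_self]
    · rw [one_mul_one_of_ne h, mul_zero]
  edge_eq_zero i x y h := by
    unfold one E
    rw [← map_mul, ← map_mul, RingQuot.mkAlgHom_rel _ (.not_edge x y i h), map_zero]

lemma tlFamily_gen (i : Fin D.rank) : D.tlFamily.gen i = D.E i := by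
  simp_rw [EdgeFamily.gen, tlFamily, ← Finset.mul_sum, sum_one, mul_one, ← Finset.sum_mul, sum_one,
    one_mul]

/-- Converse to `IsTL.lift_rel`: sandwiched between idempotents, the defining relations become
relations between individual paths. -/
lemma tlFamily_isTL (B : BitModel D) : D.tlFamily.IsTL B where
  square i x y z hy hz := by
    have h := RingQuot.mkAlgHom_rel (LaurentPolynomial ℤ) (TLRel.square i x y z hy hz)
    simp only [map_mul, map_smul, B.length_mul_simple (B.isEdge_iff.1 hy).1,
      add_sub_cancel_left] at h
    change _ = (T (B.d i x) : LaurentPolynomial ℤ) • (D.one y * D.E i * D.one z)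
    refine Eq.trans ?_ h
    change D.one y * D.E i * D.one x * (D.one x * D.E i * D.one z) =
      D.one y * D.E i * D.one x * D.E i * D.one z
    simp only [mul_assoc]
    rw [← mul_assoc (D.one x) (D.one x), one_mul_one_self]
  comm i j h ε δ x hi hj := by
    have h' : D.coxMatrix j i = 2 := by rw [D.coxMatrix.symmetric, h]
    rw [← D.tlFamily.sum_edge_mul_edge_of_two B h, ← D.tlFamily.sum_edge_mul_edge_of_two B h',
      ← D.tlFamily.vert_mul_gen_mul_gen_mul_vert, ← D.tlFamily.vert_mul_gen_mul_gen_mul_vert,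
      tlFamily_gen, tlFamily_gen, E_mul_E_comm h, B.step_comm h']
  adj i j h x y z hj hy hz := by
    rcases h with h | ⟨h, hi⟩
    · have h1 := D.tlFamily.vert_mul_gen_mul_gen_mul_gen_mul_vert i j i y z
      rw [D.tlFamily.sum_edge_mul_edge_of_adj B (.inl h), tlFamily_gen, tlFamily_gen,
        E_mul_E_mul_E h, ← tlFamily_gen, EdgeFamily.vert_mul_gen_mul_vert] at h1
      -- The sum over midpoints has a single term, at `w`; as `d j x` is nonzero, `w` must be `x`.
      obtain ⟨w, hw, hjw, h2⟩ := D.tlFamily.sum_edge_mul_edge_of_three B h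
        (B.isEdge_iff.1 (B.isEdge_symm hy)).1
      rw [h2] at h1
      obtain ⟨h3, rfl | rfl⟩ := B.isEdge_iff.1 (B.isEdge_trans hy hw)
      · exact h1.symm
      · have h4 := B.d_act_of_adj (i := j) (j := i) (.inl (by rw [D.coxMatrix.symmetric, h])) x
        have h5 := B.d_cases j (B.act i x)
        have h6 := B.d_cases j x
        have h7 := B.d_cases i x
        omega
    · have h1 := RingQuot.mkAlgHom_rel (LaurentPolynomial ℤ) (TLRel.four i j h hi x y z
        ((B.isMinimal_mul_simple_iff _ _).2 hj) hy hz)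
      simp only [map_mul] at h1
      refine Eq.trans ?_ h1
      change D.one y * D.E i * D.one x * (D.one x * D.E j * D.one x) *
        (D.one x * D.E i * D.one z) =
        D.one y * D.E i * D.one x * D.E j * D.one x * D.E i * D.one z
      simp only [mul_assoc]
      rw [← mul_assoc (D.one x) (D.one x), one_mul_one_self, ← mul_assoc (D.one x) (D.one x),
        one_mul_one_self]

end Relations

end ParabolicDatum

/-! ### Path elements and the spanning of the anti-spherical module. -/

namespace ParabolicDatum

open LaurentPolynomial (T)

variable {D : ParabolicDatum}

section Paths

lemma pathElt_mul_one {x y : D.CosetRep} (S : Quiver.Path x y) :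
    D.pathElt S * D.one y = D.pathElt S := by
  cases S with
  | nil => exact one_mul_one_self x
  | cons p e => simp [pathElt, mul_assoc]

lemma pathElt_cons {x y z : D.CosetRep} (S : Quiver.Path x y) (e : y ⟶ z) :
    D.pathElt (S.cons e) = D.pathElt S * (D.one y * D.E e.1 * D.one z) := by
  rw [pathElt, ← mul_assoc, ← mul_assoc, pathElt_mul_one]

lemma isMonomialOfDegree_pathElt {x y : D.CosetRep} (S : Quiver.Path x y) :
    D.IsMonomialOfDegree (D.pathDeg S) (D.pathElt S) := by
  induction S with
  | nil => exact .idem x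
  | cons p e ih =>
    rw [pathElt_cons, pathDeg]
    exact ih.mul (.edge e)

lemma pathElt_mem_component {x y : D.CosetRep} (S : Quiver.Path x y) :
    D.pathElt S ∈ D.component (D.pathDeg S) :=
  AddSubgroup.subset_closure (isMonomialOfDegree_pathElt S)

lemma wordE_append (ω : List (Fin D.rank)) (i : Fin D.rank) :
    D.wordE (ω ++ [i]) = D.wordE ω * D.E i := by
  simp [wordE]

/-- The element `∅ e_ω x`. -/
noncomputable def wordElt (D : ParabolicDatum) (ω : List (Fin D.rank)) (x : D.CosetRep) : D.TL :=
  D.one D.vac * D.wordE ω * D.one x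

lemma wordElt_mul_one (ω : List (Fin D.rank)) (x : D.CosetRep) :
    D.wordElt ω x * D.one x = D.wordElt ω x := by
  rw [wordElt, mul_assoc, one_mul_one_self]

variable [Fintype D.CosetRep] [DecidableEq D.CosetRep]

lemma wordElt_append (ω : List (Fin D.rank)) (i : Fin D.rank) (x : D.CosetRep) :
    D.wordElt (ω ++ [i]) x = ∑ y, D.wordElt ω y * D.tlFamily.edge i y x := by
  have h : ∀ y, D.wordElt ω y * D.tlFamily.edge i y x =
      D.one D.vac * D.wordE ω * D.one y * (D.E i * D.one x) := by
    intro y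
    conv_rhs => rw [← one_mul_one_self y]
    simp only [wordElt, tlFamily, mul_assoc]
  simp_rw [h, ← Finset.sum_mul, ← Finset.mul_sum, sum_one, mul_one, wordElt, wordE_append,
    mul_assoc]

lemma wordElt_mul_edge_of_ne {ω : List (Fin D.rank)} {x y z : D.CosetRep} {i : Fin D.rank}
    (h : x ≠ y) : D.wordElt ω x * D.tlFamily.edge i y z = 0 := by
  rw [← wordElt_mul_one, mul_assoc, show D.one x = D.tlFamily.vert x from rfl,
    D.tlFamily.vert_mul_edge, if_neg h, mul_zero]

namespace BitModel

variable {B : BitModel D}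

/-- Inserting the sum of all idempotents between letters expands the element over the paths of
weight `ω`; by `Asc.not_reach_act` at most one source survives at each step. -/
lemma Asc.wordElt_eq {ω : List (Fin D.rank)} {μ : D.CosetRep} (h : B.Asc ω μ) (x : D.CosetRep) :
    (∀ S : Quiver.Path D.vac x, D.pathWord S = ω → D.pathElt S = D.wordElt ω x) ∧
      (¬ D.Reach ω x → D.wordElt ω x = 0) := by
  induction h generalizing x with
  | nil =>
    constructor
    · intro S hS
      cases S with
      | nil => simp [pathElt, wordElt, wordE]
      | cons p e => simp [pathWord] at hS
    · rw [reach_nil_iff]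
      intro h
      simp [wordElt, wordE, one_mul_one_of_ne (Ne.symm h)]
  | @snoc ω μ i h hi ih =>
    rw [wordElt_append]
    constructor
    · intro S hS
      obtain ⟨y, S', he, hS', rfl⟩ := exists_of_pathWord_eq_append hS
      rw [pathElt_cons, (ih y).1 S' hS']
      symm
      refine Finset.sum_eq_single y (fun z _ hz ↦ ?_) (by simp)
      by_cases hzx : D.IsEdge z x i
      · obtain ⟨h1, h2 | h2⟩ := B.isEdge_iff.1 (B.isEdge_trans he (B.isEdge_symm hzx))
        · exact absurd h2 hz
        · rw [h2, (ih _).2 (h.not_reach_act hi h1 ⟨S', hS'⟩), zero_mul]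
      · rw [D.tlFamily.edge_eq_zero _ _ _ hzx, mul_zero]
    · intro hx
      refine Finset.sum_eq_zero fun y _ ↦ ?_
      by_cases hyx : D.IsEdge y x i
      · rw [(ih y).2, zero_mul]
        rintro ⟨S, hS⟩
        exact hx ⟨S.cons ⟨i, hyx⟩, by simp [pathWord, hS]⟩
      · rw [D.tlFamily.edge_eq_zero _ _ _ hyx, mul_zero]

omit [Fintype D.CosetRep] [DecidableEq D.CosetRep] in
-- Different last letters `i` and `j` are both descents of `μ`, hence commute, and the two words can
-- be compared with words ending in `j i` and `i j` with a common beginning.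
lemma Asc.wordE_eq {ω ω' : List (Fin D.rank)} {μ : D.CosetRep} (h : B.Asc ω μ)
    (h' : B.Asc ω' μ) : D.wordE ω = D.wordE ω' := by
  induction hn : ω.length using Nat.strong_induction_on generalizing ω ω' μ with
  | _ n ih =>
  have hl := h.length_eq
  have hl' := h'.length_eq
  rcases List.eq_nil_or_concat ω with rfl | ⟨ω₁, i, rfl⟩
  · obtain rfl : ω' = [] := List.eq_nil_of_length_eq_zero (by rw [hl', ← hl]; rfl)
    rfl
  rcases List.eq_nil_or_concat ω' with rfl | ⟨ω₂, j, rfl⟩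
  · simp at hl hl'; omega
  simp only [List.concat_eq_append] at h h' hl hl' hn ⊢
  rw [asc_append_iff] at h h'
  obtain ⟨h1, hi⟩ := h
  obtain ⟨h2, hj⟩ := h'
  simp only [List.length_append, List.length_singleton] at hl hl' hn
  rw [wordE_append, wordE_append]
  by_cases hij : i = j
  · subst hij
    rw [ih _ (by omega) h1 h2 rfl]
  · obtain ⟨hm, -⟩ := B.coxMatrix_eq_two hij (w := μ.1) (.inr ⟨hi, hj⟩)
    have hm' : D.coxMatrix j i = 2 := by rw [D.coxMatrix.symmetric, hm]
    obtain ⟨ω₃, h3⟩ := B.exists_asc (B.act i (B.act j μ))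
    have h4 : B.Asc (ω₃ ++ [j]) (B.act i μ) := by
      rw [asc_append_iff, B.act_comm hm', B.d_act_comm hm']
      exact ⟨h3, hj⟩
    have h5 : B.Asc (ω₃ ++ [i]) (B.act j μ) := by
      rw [asc_append_iff, B.d_act_comm hm]
      exact ⟨h3, hi⟩
    rw [ih _ (by omega) h1 h4 rfl, ih _ (by omega) h2 h5 rfl, wordE_append, wordE_append,
      mul_assoc, mul_assoc, E_mul_E_comm hm]

omit [Fintype D.CosetRep] [DecidableEq D.CosetRep] in
lemma Asc.wordElt_congr {ω ω' : List (Fin D.rank)} {μ : D.CosetRep} (h : B.Asc ω μ)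
    (h' : B.Asc ω' μ) (x : D.CosetRep) : D.wordElt ω x = D.wordElt ω' x := by
  rw [wordElt, h.wordE_eq h', wordElt]

variable (B)

/-- The span of the elements `∅ e_μ x` with `μ` of length at most `n`. -/
noncomputable def filtration (n : ℕ) : Submodule (LaurentPolynomial ℤ) D.TL :=
  Submodule.span _ {a | ∃ ω μ x, B.Asc ω μ ∧ ω.length ≤ n ∧ a = D.wordElt ω x}

variable {B}

omit [Fintype D.CosetRep] [DecidableEq D.CosetRep] in
lemma filtration_mono {m n : ℕ} (h : m ≤ n) : B.filtration m ≤ B.filtration n := by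
  refine Submodule.span_mono ?_
  rintro _ ⟨ω, μ, x, h1, h2, rfl⟩
  exact ⟨ω, μ, x, h1, h2.trans h, rfl⟩

omit [Fintype D.CosetRep] [DecidableEq D.CosetRep] in
lemma Asc.wordElt_mem {ω : List (Fin D.rank)} {μ : D.CosetRep} (h : B.Asc ω μ) (x : D.CosetRep)
    {n : ℕ} (hn : ω.length ≤ n) : D.wordElt ω x ∈ B.filtration n :=
  Submodule.subset_span ⟨ω, μ, x, h, hn, rfl⟩

lemma Asc.wordElt_mul_edge_mem_of_eq_one {ω : List (Fin D.rank)} {μ : D.CosetRep} (h : B.Asc ω μ)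
    {i : Fin D.rank} (hi : B.d i μ = 1) (x y : D.CosetRep) {n : ℕ} (hn : ω.length + 1 ≤ n) :
    D.wordElt ω x * D.tlFamily.edge i x y ∈ B.filtration n := by
  by_cases hx : D.Reach ω x
  swap
  · rw [(h.wordElt_eq x).2 hx, zero_mul]; exact zero_mem _
  by_cases he : D.IsEdge x y i
  swap
  · rw [D.tlFamily.edge_eq_zero _ _ _ he, mul_zero]; exact zero_mem _
  obtain ⟨S, hS⟩ := hx
  have h1 := ((h.snoc i hi).wordElt_eq y).1 (S.cons ⟨i, he⟩) (by simp [pathWord, hS])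
  rw [pathElt_cons, (h.wordElt_eq x).1 S hS] at h1
  change D.wordElt ω x * (D.one x * D.E i * D.one y) ∈ _
  rw [h1]
  exact (h.snoc i hi).wordElt_mem y (by simpa using hn)

omit [Fintype D.CosetRep] [DecidableEq D.CosetRep] in
-- The pairing with the long node changes by 2, so it cannot become 0. This excludes the one
-- configuration for which no relation shortens the word.
lemma d_act_ne_zero_of_four {i j : Fin D.rank} (hi : i ∉ D.short) (h : D.coxMatrix i j = 4)
    {u : D.CosetRep} (hj : B.d j u = 1) : B.d i (B.act j u) ≠ 0 := by
  have hij : i ≠ j := by rintro rfl; simp at h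
  have h1 := B.d_cases i u
  rcases B.cartan i j hij with h2 | h2 | h2 | ⟨-, -, -, -, h3⟩
  · omega
  · omega
  · exact absurd h2.2.1 hi
  · rw [d_act, h3]; omega

/-- If `i` is a descent of `μ`, a reduced word ends in `i` and the square relation applies. If the
pairing is 0, the last letter `j` either commutes with `i` or completes a pattern `i j i` that
collapses to `i`. The second half of the statement serves the commuting case: the factor `i` must
not raise the degree before `j` is put back. -/
lemma Asc.wordElt_mul_edge_mem {ω : List (Fin D.rank)} {μ : D.CosetRep} (h : B.Asc ω μ)
    (i : Fin D.rank) (x y : D.CosetRep) :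
    D.wordElt ω x * D.tlFamily.edge i x y ∈ B.filtration (ω.length + 1) ∧
      (B.d i μ ≠ 1 → D.wordElt ω x * D.tlFamily.edge i x y ∈ B.filtration ω.length) := by
  induction hn : ω.length using Nat.strong_induction_on generalizing ω μ i x y with
  | _ n ih =>
  by_cases h1 : B.d i μ = 1
  · exact ⟨h.wordElt_mul_edge_mem_of_eq_one h1 x y (by omega), fun h2 ↦ absurd h1 h2⟩
  have hTL := tlFamily_isTL B
  suffices H : D.wordElt ω x * D.tlFamily.edge i x y ∈ B.filtration n from
    ⟨filtration_mono (Nat.le_succ n) H, fun _ ↦ H⟩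
  by_cases hxy : D.IsEdge x y i
  swap
  · rw [D.tlFamily.edge_eq_zero _ _ _ hxy, mul_zero]; exact zero_mem _
  rcases B.d_cases i μ with h2 | h2 | h2
  · obtain ⟨ω', h3⟩ := B.exists_asc (B.act i μ)
    have h4 : B.Asc (ω' ++ [i]) μ := asc_append_iff.2 ⟨h3, h2⟩
    have hl : ω'.length + 1 = n := by
      rw [← hn, h.length_eq, ← h4.length_eq]; simp
    rw [h.wordElt_congr h4, wordElt_append, Finset.sum_mul]
    refine Submodule.sum_mem _ fun z _ ↦ ?_
    by_cases hz : D.IsEdge z x i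
    swap
    · rw [D.tlFamily.edge_eq_zero _ _ _ hz, mul_zero, zero_mul]; exact zero_mem _
    rw [mul_assoc, hTL.square i x z y (B.isEdge_symm hz) hxy, mul_smul_comm]
    exact Submodule.smul_mem _ _
      (h3.wordElt_mul_edge_mem_of_eq_one (by rw [d_act_self, h2]; rfl) z y (by omega))
  · by_cases hμ : μ = D.vac
    · subst hμ
      obtain rfl : ω = [] := List.eq_nil_of_length_eq_zero (by rw [h.length_eq]; simp [vac])
      by_cases hx : x = D.vac
      · subst hx
        exact absurd h2 (B.isEdge_iff.1 hxy).1
      · rw [(h.wordElt_eq x).2 (by rwa [reach_nil_iff]), zero_mul]; exact zero_mem _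
    obtain ⟨u, j, rfl, hj, -⟩ := B.exists_eq_act hμ
    obtain ⟨ω', h3⟩ := B.exists_asc u
    have h4 := h3.snoc j hj
    have hl : ω'.length + 1 = n := by
      rw [← hn, h.length_eq, ← h4.length_eq]; simp
    have hij : i ≠ j := by rintro rfl; rw [d_act_self] at h2; omega
    rw [h.wordElt_congr h4, wordElt_append, Finset.sum_mul]
    refine Submodule.sum_mem _ fun z _ ↦ ?_
    by_cases hz : D.IsEdge z x j
    swap
    · rw [D.tlFamily.edge_eq_zero _ _ _ hz, mul_zero, zero_mul]; exact zero_mem _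
    rcases B.coxMatrix_cases hij with hm | hm | ⟨hi, hm⟩
    · have hm' : D.coxMatrix j i = 2 := by rw [D.coxMatrix.symmetric, hm]
      obtain ⟨hd, δ, rfl⟩ := B.isEdge_iff_step.1 hz
      obtain ⟨hd', ε, rfl⟩ := B.isEdge_iff_step.1 hxy
      rw [B.d_step_comm hm] at hd'
      rw [mul_assoc, hTL.comm j i hm' δ ε z hd hd', ← mul_assoc]
      have h5 := (ih _ (by omega) h3 i z (B.step ε i z) rfl).2 (by
        rw [B.d_act_comm hm] at h2; omega)
      generalize B.step δ j (B.step ε i z) = t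
      generalize B.step ε i z = v at *
      generalize D.wordElt ω' z * D.tlFamily.edge i z v = a at h5
      induction h5 using Submodule.span_induction with
      | mem a ha =>
        obtain ⟨ω'', μ'', x'', h6, h7, rfl⟩ := ha
        by_cases hx : x'' = v
        · subst hx
          exact filtration_mono (by omega) (ih _ (by omega) h6 j x'' t rfl).1
        · rw [wordElt_mul_edge_of_ne hx]; exact zero_mem _
      | zero => rw [zero_mul]; exact zero_mem _
      | add a b _ _ ha hb => rw [add_mul]; exact add_mem ha hb
      | smul c a _ ha => rw [smul_mul_assoc]; exact Submodule.smul_mem _ _ ha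
    -- So `u` has a reduced word ending in `i`, and the edge completes `i j i`.
    · have h5 : B.d i u = -1 := by rw [B.d_act_of_adj hm] at h2; omega
      obtain ⟨ω'', h6⟩ := B.exists_asc (B.act i u)
      have h7 : B.Asc (ω'' ++ [i]) u := asc_append_iff.2 ⟨h6, h5⟩
      have hl' : ω''.length + 1 = ω'.length := by
        rw [h3.length_eq, ← h7.length_eq]; simp
      rw [h3.wordElt_congr h7, wordElt_append, Finset.sum_mul, Finset.sum_mul]
      refine Submodule.sum_mem _ fun w _ ↦ ?_
      by_cases hw : D.IsEdge w z i
      swap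
      · rw [D.tlFamily.edge_eq_zero _ _ _ hw, mul_zero, zero_mul, zero_mul]; exact zero_mem _
      obtain ⟨hjz, rfl | rfl⟩ := B.isEdge_iff.1 hz
      · rw [mul_assoc, mul_assoc, ← mul_assoc (D.tlFamily.edge i w x),
          hTL.adj i j hm _ _ _ hjz (B.isEdge_symm hw) hxy]
        exact h6.wordElt_mul_edge_mem_of_eq_one (by rw [d_act_self, h5]; rfl) w y (by omega)
      · have := (B.isEdge_iff.1 hxy).1
        exact absurd (B.d_act_eq_zero_of_adj hm (B.isEdge_iff.1 (B.isEdge_symm hw)).1 hjz) this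
    · exact absurd h2 (d_act_ne_zero_of_four hi hm hj)
  · exact absurd h2 h1

variable (B)

/-- The span of all elements `∅ e_μ x`. -/
noncomputable def wordSpan : Submodule (LaurentPolynomial ℤ) D.TL :=
  Submodule.span _ {a | ∃ ω μ x, B.Asc ω μ ∧ a = D.wordElt ω x}

variable {B}

omit [Fintype D.CosetRep] [DecidableEq D.CosetRep] in
lemma filtration_le_wordSpan (n : ℕ) : B.filtration n ≤ B.wordSpan := by
  refine Submodule.span_mono ?_
  rintro _ ⟨ω, μ, x, h1, h2, rfl⟩
  exact ⟨ω, μ, x, h1, rfl⟩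

end BitModel

end Paths

/-- An induction principle for the elements of the Temperley--Lieb algebra. -/
lemma TL.induction {p : D.TL → Prop} (a : D.TL)
    (algebraMap : ∀ r, p (algebraMap (LaurentPolynomial ℤ) D.TL r))
    (one : ∀ x, p (D.one x)) (E : ∀ i, p (D.E i))
    (mul : ∀ a b, p a → p b → p (a * b)) (add : ∀ a b, p a → p b → p (a + b)) : p a := by
  obtain ⟨a, rfl⟩ := RingQuot.mkAlgHom_surjective (LaurentPolynomial ℤ) D.TLRel a
  induction a using FreeAlgebra.induction with
  | grade0 r => rw [AlgHom.commutes]; exact algebraMap r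
  | grade1 x =>
    cases x with
    | idem x => exact one x
    | cupcap i => exact E i
  | mul a b ha hb => rw [map_mul]; exact mul _ _ ha hb
  | add a b ha hb => rw [map_add]; exact add _ _ ha hb

namespace BitModel

variable {B : BitModel D} [Fintype D.CosetRep] [DecidableEq D.CosetRep]

lemma mul_mem_wordSpan {a : D.TL} (ha : a ∈ B.wordSpan) (b : D.TL) : a * b ∈ B.wordSpan := by
  induction b using TL.induction generalizing a with
  | algebraMap r =>
    rw [← Algebra.commutes, ← Algebra.smul_def]
    exact Submodule.smul_mem _ _ ha
  | one y =>
    induction ha using Submodule.span_induction with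
    | mem a ha =>
      obtain ⟨ω, μ, x, h, rfl⟩ := ha
      rw [wordElt, mul_assoc, one_mul_one]
      split_ifs
      · exact Submodule.subset_span ⟨ω, μ, x, h, rfl⟩
      · rw [mul_zero]; exact zero_mem _
    | zero => rw [zero_mul]; exact zero_mem _
    | add a b _ _ ha hb => rw [add_mul]; exact add_mem ha hb
    | smul c a _ ha => rw [smul_mul_assoc]; exact Submodule.smul_mem _ _ ha
  | E i =>
    induction ha using Submodule.span_induction with
    | mem a ha =>
      obtain ⟨ω, μ, x, h, rfl⟩ := ha
      rw [← tlFamily_gen, EdgeFamily.gen, Finset.mul_sum]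
      refine Submodule.sum_mem _ fun y _ ↦ ?_
      rw [Finset.mul_sum]
      refine Submodule.sum_mem _ fun z _ ↦ ?_
      by_cases hxy : x = y
      · subst hxy
        exact filtration_le_wordSpan _ (h.wordElt_mul_edge_mem i x z).1
      · rw [wordElt_mul_edge_of_ne hxy]; exact zero_mem _
    | zero => rw [zero_mul]; exact zero_mem _
    | add a b _ _ ha hb => rw [add_mul]; exact add_mem ha hb
    | smul c a _ ha => rw [smul_mul_assoc]; exact Submodule.smul_mem _ _ ha
  | mul b c hb hc => rw [← mul_assoc]; exact hc (hb ha)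
  | add b c hb hc => rw [mul_add]; exact add_mem (hb ha) (hc ha)

variable (B)

lemma antispherical_eq : D.antispherical = B.wordSpan := by
  apply le_antisymm
  · rintro _ ⟨a, rfl⟩
    refine mul_mem_wordSpan (Submodule.subset_span ⟨[], D.vac, D.vac, .nil, ?_⟩) a
    simp [wordElt, wordE]
  · refine Submodule.span_le.2 ?_
    rintro _ ⟨ω, μ, x, h, rfl⟩
    exact ⟨D.wordE ω * D.one x, by simp [wordElt, mul_assoc]⟩

end BitModel

end ParabolicDatum

/-! ### The grading, via a coaction recording degrees. -/

namespace ParabolicDatum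

open LaurentPolynomial (T C)

variable {D : ParabolicDatum}

namespace BitModel

variable (B : BitModel D)

open Classical in
/-- The degree of an edge from `x` to `y`. -/
noncomputable def deg (i : Fin D.rank) (x y : D.CosetRep) : ℤ := if y = x then B.d i x else 0

lemma edgeDeg_eq_deg {x y : D.CosetRep} (e : x ⟶ y) : D.edgeDeg e = B.deg e.1 x y := by
  rw [B.edgeDeg_eq, deg]

lemma deg_self (i : Fin D.rank) (x : D.CosetRep) : B.deg i x x = B.d i x := by simp [deg]

lemma deg_step {i : Fin D.rank} {x : D.CosetRep} (h : B.d i x ≠ 0) (ε : Bool) :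
    B.deg i x (B.step ε i x) = if ε then 0 else B.d i x := by
  cases ε <;> simp [deg, step, B.act_ne h]

/-- Together with `deg_comm` and `deg_adj`: homogeneity of the relations. It is used for the
coaction and again for the powers of `q` in `repFamily`. -/
lemma deg_square {i : Fin D.rank} {x y z : D.CosetRep} (hy : D.IsEdge x y i)
    (hz : D.IsEdge x z i) : B.deg i y x + B.deg i x z = B.d i x + B.deg i y z := by
  obtain ⟨h, rfl | rfl⟩ := B.isEdge_iff.1 hy <;> obtain ⟨-, rfl | rfl⟩ := B.isEdge_iff.1 hz <;>
    simp [deg, B.act_ne h, (B.act_ne h).symm]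

lemma deg_comm {i j : Fin D.rank} (h : D.coxMatrix i j = 2) (ε δ : Bool) {x : D.CosetRep}
    (hi : B.d i x ≠ 0) (hj : B.d j x ≠ 0) :
    B.deg i x (B.step ε i x) + B.deg j (B.step ε i x) (B.step δ j (B.step ε i x)) =
      B.deg j x (B.step δ j x) + B.deg i (B.step δ j x) (B.step ε i (B.step δ j x)) := by
  have h' : D.coxMatrix j i = 2 := by rw [D.coxMatrix.symmetric, h]
  rw [B.deg_step hi, B.deg_step hj, B.deg_step (by rwa [B.d_step_comm h']),
    B.deg_step (by rwa [B.d_step_comm h]), B.d_step_comm h, B.d_step_comm h', add_comm]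

lemma deg_adj {i j : Fin D.rank} (h : D.Adj i j) {x y z : D.CosetRep} (hj : B.d j x ≠ 0)
    (hy : D.IsEdge x y i) (hz : D.IsEdge x z i) :
    B.deg i y x + B.d j x + B.deg i x z = B.deg i y z := by
  have h1 := B.deg_square hy hz
  have h2 := B.d_eq_neg_of_adj h (B.isEdge_iff.1 hy).1 hj
  omega

end BitModel

section Grading

/-- Laurent polynomials in a central variable `t` over a ring; as an algebra over the Laurent
polynomials in `q`, the variable `q` acts as `q t`. -/
def TwistedLaurent (A : Type*) [Ring A] : Type _ := LaurentPolynomial A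

namespace TwistedLaurent

variable {A : Type*} [Ring A]

noncomputable instance : Ring (TwistedLaurent A) := inferInstanceAs (Ring (LaurentPolynomial A))

/-- The element `a t ^ n`. -/
noncomputable def mono (n : ℤ) (a : A) : TwistedLaurent A := AddMonoidAlgebra.single n a

/-- The coefficient of `t ^ n`. -/
noncomputable def coeff (x : TwistedLaurent A) (n : ℤ) : A := AddMonoidAlgebra.coeff x n

lemma coeff_zero (n : ℤ) : coeff (0 : TwistedLaurent A) n = 0 := rfl

lemma coeff_add (x y : TwistedLaurent A) (n : ℤ) : coeff (x + y) n = coeff x n + coeff y n := rfl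

lemma coeff_mono (m n : ℤ) (a : A) : coeff (mono m a) n = if m = n then a else 0 :=
  Finsupp.single_apply

lemma mono_mul_mono (m n : ℤ) (a b : A) : mono m a * mono n b = mono (m + n) (a * b) :=
  AddMonoidAlgebra.single_mul_single ..

lemma mono_add (m : ℤ) (a b : A) : mono m (a + b) = mono m a + mono m b :=
  AddMonoidAlgebra.single_add ..

lemma mono_zero (m : ℤ) : mono m (0 : A) = 0 := AddMonoidAlgebra.single_zero ..

lemma induction {p : TwistedLaurent A → Prop} (x : TwistedLaurent A) (zero : p 0)
    (add : ∀ x y, p x → p y → p (x + y)) (mono : ∀ n a, p (mono n a)) : p x :=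
  AddMonoidAlgebra.induction_linear x zero add mono

lemma mono_sum {ι : Type*} (s : Finset ι) (m : ℤ) (a : ι → A) :
    mono m (∑ i ∈ s, a i) = ∑ i ∈ s, mono m (a i) :=
  map_sum (AddMonoidHom.mk' (mono m) (mono_add m)) a s

lemma mono_zero_one : mono 0 (1 : A) = 1 := rfl

variable [Algebra (LaurentPolynomial ℤ) A]

variable (A) in
/-- The ring homomorphism sending `q` to `q t`. -/
noncomputable def twist : LaurentPolynomial ℤ →+* TwistedLaurent A :=
  (AddMonoidAlgebra.lift ℤ (TwistedLaurent A) ℤ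
    { toFun := fun n ↦ mono n.toAdd (algebraMap (LaurentPolynomial ℤ) A (T n.toAdd))
      map_one' := by
        rw [toAdd_one, LaurentPolynomial.T_zero, map_one, mono_zero_one]
      map_mul' := fun m n ↦ by
        rw [toAdd_mul, LaurentPolynomial.T_add, map_mul, mono_mul_mono] }).toRingHom

lemma twist_T (n : ℤ) : twist A (T n) = mono n (algebraMap (LaurentPolynomial ℤ) A (T n)) := by
  change AddMonoidAlgebra.lift ℤ (TwistedLaurent A) ℤ _ (AddMonoidAlgebra.single n 1) = _
  rw [AddMonoidAlgebra.lift_single, one_smul]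
  rfl

lemma twist_comm (p : LaurentPolynomial ℤ) (x : TwistedLaurent A) :
    twist A p * x = x * twist A p := by
  induction p using LaurentPolynomial.induction_on' with
  | add p q hp hq => rw [map_add, add_mul, mul_add, hp, hq]
  | C_mul_T n a =>
    rw [show (C a : LaurentPolynomial ℤ) = (a : LaurentPolynomial ℤ) by simp, map_mul, map_intCast,
      mul_assoc, ← mul_assoc x, ← (Int.cast_commute a x).eq, mul_assoc, twist_T]
    congr 1
    induction x using induction with
    | zero => rw [mul_zero, zero_mul]
    | add x y hx hy => rw [mul_add, add_mul, hx, hy]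
    | mono m b =>
      rw [mono_mul_mono, mono_mul_mono, add_comm, Algebra.commutes]

noncomputable instance : Algebra (LaurentPolynomial ℤ) (TwistedLaurent A) :=
  (twist A).toAlgebra' twist_comm

lemma T_smul_mono (m n : ℤ) (a : A) :
    (T m : LaurentPolynomial ℤ) • mono n a = mono (m + n) ((T m : LaurentPolynomial ℤ) • a) := by
  rw [Algebra.smul_def, Algebra.smul_def]
  change twist A _ * _ = _
  rw [twist_T, mono_mul_mono]

end TwistedLaurent

open TwistedLaurent

variable [Fintype D.CosetRep] [DecidableEq D.CosetRep] (B : BitModel D)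

/-- The edges of the extended Bruhat graph, with their degrees recorded. -/
noncomputable def gradedFamily : D.EdgeFamily (TwistedLaurent D.TL) where
  vert x := mono 0 (D.one x)
  edge i x y := mono (B.deg i x y) (D.tlFamily.edge i x y)
  vert_mul_vert x y := by
    rw [mono_mul_mono, add_zero, show D.one x * D.one y = _ from D.tlFamily.vert_mul_vert x y]
    split_ifs
    · rfl
    · exact mono_zero 0
  sum_vert := by rw [← mono_sum, sum_one, mono_zero_one]
  vert_mul_edge i x y z := by
    rw [mono_mul_mono, zero_add, show D.one x * _ = _ from D.tlFamily.vert_mul_edge i x y z]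
    split_ifs
    · rfl
    · exact mono_zero _
  edge_mul_vert i x y z := by
    rw [mono_mul_mono, add_zero, show _ * D.one x = _ from D.tlFamily.edge_mul_vert i x y z]
    split_ifs
    · rfl
    · exact mono_zero _
  edge_eq_zero i x y h := by rw [D.tlFamily.edge_eq_zero i x y h, mono_zero]

lemma gradedFamily_isTL : (gradedFamily B).IsTL B where
  square i x y z hy hz := by
    simp only [gradedFamily]
    rw [mono_mul_mono, (tlFamily_isTL B).square i x y z hy hz, B.deg_square hy hz, T_smul_mono]
  comm i j h ε δ x hi hj := by
    simp only [gradedFamily]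
    rw [mono_mul_mono, mono_mul_mono, (tlFamily_isTL B).comm i j h ε δ x hi hj,
      B.deg_comm h ε δ hi hj]
  adj i j h x y z hj hy hz := by
    simp only [gradedFamily]
    rw [mono_mul_mono, mono_mul_mono, (tlFamily_isTL B).adj i j h x y z hj hy hz, B.deg_self,
      B.deg_adj h hj hy hz]

/-- The coaction recording the degrees. -/
noncomputable def gradingHom : D.TL →ₐ[LaurentPolynomial ℤ] (TwistedLaurent D.TL) :=
  (gradedFamily_isTL B).hom

lemma gradingHom_of_mem {n : ℤ} {a : D.TL} (ha : a ∈ D.component n) :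
    gradingHom B a = mono n a := by
  have key : ∀ (n : ℤ) (a : D.TL), D.IsMonomialOfDegree n a → gradingHom B a = mono n a := by
    intro n a h
    induction h with
    | q n => rw [AlgHom.commutes]; exact twist_T n
    | idem x => exact (gradedFamily_isTL B).hom_one x
    | @edge x y e => rw [B.edgeDeg_eq_deg]; exact (gradedFamily_isTL B).hom_edge e.1 x y
    | mul _ _ h h' => rw [map_mul, h, h', mono_mul_mono]
  induction ha using AddSubgroup.closure_induction with
  | mem a h => exact key n a h
  | zero => rw [map_zero, mono_zero]
  | add a b _ _ ha hb => rw [map_add, ha, hb, mono_add]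
  | neg a _ ha =>
    rw [map_neg, ha, neg_eq_iff_add_eq_zero, ← mono_add, add_neg_cancel, mono_zero]

omit [Fintype D.CosetRep] [DecidableEq D.CosetRep] in
lemma mul_mem_component {m n : ℤ} {a b : D.TL} (ha : a ∈ D.component m)
    (hb : b ∈ D.component n) : a * b ∈ D.component (m + n) := by
  have mul_neg' : ∀ {R : Type} [Ring R] (a b : R), a * -b = -(a * b) := fun a b ↦ mul_neg a b
  have neg_mul' : ∀ {R : Type} [Ring R] (a b : R), -a * b = -(a * b) := fun a b ↦ neg_mul a b
  induction ha using AddSubgroup.closure_induction with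
  | mem a ha =>
    induction hb using AddSubgroup.closure_induction with
    | mem b hb => exact AddSubgroup.subset_closure (ha.mul hb)
    | zero => rw [mul_zero]; exact zero_mem _
    | add x y _ _ hx hy => rw [mul_add]; exact add_mem hx hy
    | neg x _ hx => convert neg_mem hx using 1; exact mul_neg' a x
  | zero => rw [zero_mul]; exact zero_mem _
  | add x y _ _ hx hy => rw [add_mul]; exact add_mem hx hy
  | neg x _ hx => convert neg_mem hx using 1; exact neg_mul' x b

lemma mem_iSup_component (a : D.TL) : a ∈ ⨆ n, D.component n := by
  have mem : ∀ {n : ℤ} {a : D.TL}, a ∈ D.component n → a ∈ ⨆ n, D.component n :=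
    fun {n a} h ↦ (le_iSup D.component n) h
  induction a using TL.induction with
  | algebraMap r =>
    induction r using LaurentPolynomial.induction_on' with
    | add p q hp hq => rw [map_add]; exact add_mem hp hq
    | C_mul_T n a =>
      rw [show (C a : LaurentPolynomial ℤ) = (a : LaurentPolynomial ℤ) by simp, map_mul,
        map_intCast, ← zsmul_eq_mul]
      exact zsmul_mem (mem (AddSubgroup.subset_closure (.q n))) a
  | one x => exact mem (AddSubgroup.subset_closure (.idem x))
  | E i =>
    rw [← tlFamily_gen]
    refine sum_mem fun x _ ↦ sum_mem fun y _ ↦ ?_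
    by_cases h : D.IsEdge x y i
    · exact mem (AddSubgroup.subset_closure (.edge (x := x) (y := y) ⟨i, h⟩))
    · rw [D.tlFamily.edge_eq_zero _ _ _ h]; exact zero_mem _
  | mul a b ha hb =>
    induction ha using AddSubgroup.iSup_induction' with
    | hp m a ha =>
      induction hb using AddSubgroup.iSup_induction' with
      | hp n b hb => exact mem (mul_mem_component ha hb)
      | h1 => rw [mul_zero]; exact zero_mem _
      | hadd x y _ _ hx hy => rw [mul_add]; exact add_mem hx hy
    | h1 => rw [zero_mul]; exact zero_mem _
    | hadd x y _ _ hx hy => rw [add_mul]; exact add_mem hx hy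
  | add a b ha hb => exact add_mem ha hb

include B in
lemma isInternal_component : DirectSum.IsInternal D.component := by
  constructor
  -- The coefficient of `t ^ n` recovers the component of degree `n`, which gives injectivity.
  · have key : ∀ x : DirectSum ℤ fun n ↦ D.component n, ∀ n : ℤ,
        coeff (gradingHom B (DirectSum.coeAddMonoidHom D.component x)) n = x n := by
      intro x n
      induction x using DirectSum.induction_on with
      | zero =>
        rw [map_zero, map_zero, coeff_zero]; rfl
      | of m a =>
        rw [DirectSum.coeAddMonoidHom_of, gradingHom_of_mem B a.2, coeff_mono, DirectSum.of_apply]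
        split_ifs with h
        · subst h; rfl
        · rfl
      | add x y hx hy =>
        rw [map_add, map_add, coeff_add, DirectSum.add_apply, hx, hy]
        rfl
    intro x y h
    ext n
    rw [← key, ← key, h]
  · intro a
    induction mem_iSup_component (D := D) a using AddSubgroup.iSup_induction' with
    | hp n b hb => exact ⟨DirectSum.of _ n ⟨b, hb⟩, DirectSum.coeAddMonoidHom_of ..⟩
    | h1 => exact ⟨0, map_zero _⟩
    | hadd x y _ _ hx hy =>
      obtain ⟨x, rfl⟩ := hx
      obtain ⟨y, rfl⟩ := hy
      exact ⟨x + y, map_add ..⟩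

end Grading

end ParabolicDatum

/-! ### A representation proving linear independence. -/

namespace ParabolicDatum

open LaurentPolynomial (T C)

variable {D : ParabolicDatum}

section Weights

/-- Weights of the loops for a representation of the Temperley--Lieb algebra in which `E_i` is
idempotent: `ζ` for short and `θ` for long simple roots. -/
structure LoopWeights (K : Type*) [CommRing K] where
  ζ : K
  θ : K
  -- At nodes with `m = 3` the two loops have opposite degrees, so their weights are `ζ` and `1 -
  -- ζ`.
  hζ : ζ * (1 - ζ) = 1
  -- For `m = 4` both `x` and `x s_i` contribute a loop labelled `j`, so a sum of two products has
  -- to be 1.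
  hθ : ζ * (1 - θ) + (1 - ζ) * θ = 1

variable {K : Type*} [CommRing K] (w : LoopWeights K)

open Classical in
/-- The weight of a loop of degree `s` labelled `i`. -/
noncomputable def LoopWeights.loop (i : Fin D.rank) (s : ℤ) : K :=
  if i ∈ D.short then (if s = 1 then w.ζ else 1 - w.ζ) else (if s = 1 then w.θ else 1 - w.θ)

lemma LoopWeights.loop_add (i : Fin D.rank) {s : ℤ} (hs : s = 1 ∨ s = -1) :
    w.loop i s + w.loop i (-s) = 1 := by
  rcases hs with rfl | rfl <;> by_cases h : i ∈ D.short <;> simp [loop, h]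

lemma LoopWeights.loop_mul {i j : Fin D.rank} (hi : i ∈ D.short) (hj : j ∈ D.short) {s : ℤ}
    (hs : s = 1 ∨ s = -1) : w.loop i s * w.loop j (-s) = 1 := by
  rcases hs with rfl | rfl <;> simp [loop, hi, hj, w.hζ, mul_comm (1 - w.ζ)]

lemma LoopWeights.loop_mul_add {i j : Fin D.rank} (hi : i ∈ D.short) (hj : j ∉ D.short) {s : ℤ}
    (hs : s = 1 ∨ s = -1) :
    w.loop i s * w.loop j (-s) + w.loop i (-s) * w.loop j s = 1 := by
  have h := w.hθ
  rcases hs with rfl | rfl <;> simp [loop, hi, hj]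
  · exact h
  · rw [add_comm]; exact h

namespace BitModel

variable (B : BitModel D)

open Classical in
/-- The matrix coefficients of `E_i`. -/
noncomputable def entry (i : Fin D.rank) (x y : D.CosetRep) : K :=
  if D.IsEdge x y i then
    -- On a pair `x, x s_i` this is a rank one block with diagonal `a, b` and off-diagonal entries
    -- `1, a b`. It is idempotent because `a + b = 1`; the 1 sits on the ascending edge, which makes
    -- words unitriangular.
    if y = x then w.loop i (B.d i x) else if B.d i x = 1 then 1 else w.loop i 1 * w.loop i (-1)
  else 0

lemma entry_eq_zero (i : Fin D.rank) (x y : D.CosetRep) (h : ¬ D.IsEdge x y i) :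
    B.entry w i x y = 0 := by simp [entry, h]

lemma entry_self {i : Fin D.rank} {x : D.CosetRep} (h : B.d i x ≠ 0) :
    B.entry w i x x = w.loop i (B.d i x) := by
  simp [entry, B.isEdge_iff, h]

lemma entry_act {i : Fin D.rank} {x : D.CosetRep} (h : B.d i x ≠ 0) :
    B.entry w i x (B.act i x) = if B.d i x = 1 then 1 else w.loop i 1 * w.loop i (-1) := by
  simp [entry, B.isEdge_iff, h, B.act_ne h]

lemma entry_step {i : Fin D.rank} {x : D.CosetRep} (h : B.d i x ≠ 0) (ε : Bool) :
    B.entry w i x (B.step ε i x) = if ε then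
      (if B.d i x = 1 then 1 else w.loop i 1 * w.loop i (-1)) else w.loop i (B.d i x) := by
  cases ε
  · simpa [step] using B.entry_self w h
  · simpa [step] using B.entry_act w h

lemma d_eq_or {i : Fin D.rank} {x : D.CosetRep} (h : B.d i x ≠ 0) :
    B.d i x = 1 ∨ B.d i x = -1 := by
  have := B.d_cases i x
  omega

lemma entry_mul_entry {i : Fin D.rank} {x y z : D.CosetRep} (hy : D.IsEdge x y i)
    (hz : D.IsEdge x z i) :
    B.entry w i y x * B.entry w i x z = w.loop i (B.d i x) * B.entry w i y z := by
  obtain ⟨h, hy⟩ := B.isEdge_iff.1 hy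
  obtain ⟨-, hz⟩ := B.isEdge_iff.1 hz
  have h' : B.d i (B.act i x) ≠ 0 := by simpa using h
  have hs : B.entry w i (B.act i x) x =
      if B.d i x = -1 then 1 else w.loop i 1 * w.loop i (-1) := by
    have := B.entry_act w h'
    rw [act_act, d_act_self] at this
    rw [this]
    congr 1
    exact propext ⟨fun _ ↦ by omega, fun _ ↦ by omega⟩
  rcases hy with rfl | rfl <;> rcases hz with rfl | rfl
  · rw [B.entry_self w h]
  · rw [B.entry_self w h]
  · rw [hs, B.entry_self w h, mul_comm]
  · rw [hs, B.entry_act w h, B.entry_self w h', d_act_self]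
    rcases B.d_eq_or h with h1 | h1 <;> simp [h1, mul_comm]

end BitModel

end Weights

section Representation

variable [Fintype D.CosetRep] [DecidableEq D.CosetRep]

/-- Matrix units indexed by the extended Bruhat graph, with coefficients. -/
def matrixFamily {M : Type*} [Ring M] (c : Fin D.rank → D.CosetRep → D.CosetRep → M)
    (hc : ∀ i x y, ¬ D.IsEdge x y i → c i x y = 0) :
    D.EdgeFamily (Matrix D.CosetRep D.CosetRep M) where
  vert x := Matrix.single x x 1
  edge i x y := Matrix.single x y (c i x y)
  vert_mul_vert x y := by
    split_ifs with h
    · subst h; rw [Matrix.single_mul_single_same, mul_one]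
    · exact Matrix.single_mul_single_of_ne _ _ _ _ h _
  sum_vert := by
    ext a b
    simp only [Matrix.sum_apply, Matrix.single_apply, Matrix.one_apply]
    by_cases h : a = b
    · subst h; simp
    · rw [if_neg h]
      exact Finset.sum_eq_zero fun x _ ↦ if_neg fun hx ↦ h (hx.1.symm.trans hx.2)
  vert_mul_edge i x y z := by
    split_ifs with h
    · subst h; rw [Matrix.single_mul_single_same, one_mul]
    · exact Matrix.single_mul_single_of_ne _ _ _ _ h _
  edge_mul_vert i x y z := by
    split_ifs with h
    · subst h; rw [Matrix.single_mul_single_same, mul_one]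
    · exact Matrix.single_mul_single_of_ne _ _ _ _ h _
  edge_eq_zero i x y h := by rw [hc i x y h, Matrix.single_zero]

lemma matrixFamily_gen_apply {M : Type*} [Ring M] (c : Fin D.rank → D.CosetRep → D.CosetRep → M)
    (hc : ∀ i x y, ¬ D.IsEdge x y i → c i x y = 0) (i : Fin D.rank) (x y : D.CosetRep) :
    (matrixFamily c hc).gen i x y = c i x y := by
  have h : (matrixFamily c hc).gen i = Matrix.of (c i) :=
    (Matrix.matrix_eq_sum_single (Matrix.of (c i))).symm
  rw [h, Matrix.of_apply]

variable {K : Type*} [CommRing K] (w : LoopWeights K) (B : BitModel D)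

namespace BitModel

lemma sum_of_isEdge {A : Type*} [AddCommMonoid A] {i : Fin D.rank} {x : D.CosetRep}
    (hx : B.d i x ≠ 0) (f : D.CosetRep → A) (hf : ∀ y, ¬ D.IsEdge x y i → f y = 0) :
    ∑ y, f y = f x + f (B.act i x) := by
  rw [← Finset.sum_pair (B.act_ne hx).symm]
  refine (Finset.sum_subset (Finset.subset_univ _) fun y _ hy ↦ hf y fun h ↦ hy ?_).symm
  obtain ⟨-, rfl | rfl⟩ := B.isEdge_iff.1 h <;> simp

/-- The matrices of the generators `E_i`, as idempotents. -/
noncomputable def loopFamily : D.EdgeFamily (Matrix D.CosetRep D.CosetRep K) :=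
  matrixFamily (B.entry w) (B.entry_eq_zero w)

lemma loopFamily_edge_mul_edge (i j : Fin D.rank) (x y z : D.CosetRep) :
    (B.loopFamily w).edge i x y * (B.loopFamily w).edge j y z =
      Matrix.single x z (B.entry w i x y * B.entry w j y z) :=
  Matrix.single_mul_single_same ..

lemma loopFamily_gen_mul_self (i : Fin D.rank) :
    (B.loopFamily w).gen i * (B.loopFamily w).gen i = (B.loopFamily w).gen i := by
  apply (B.loopFamily w).eq_of_vert_mul_mul_vert
  intro x z
  rw [EdgeFamily.vert_mul_gen_mul_gen_mul_vert, EdgeFamily.vert_mul_gen_mul_vert]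
  by_cases hx : B.d i x = 0
  · have h : ∀ y, (B.loopFamily w).edge i x y = 0 := fun y ↦
      EdgeFamily.edge_eq_zero _ _ _ _ (by simp [B.isEdge_iff, hx])
    simp [h]
  have h1 : D.IsEdge x (B.act i x) i := B.isEdge_iff.2 ⟨hx, .inr rfl⟩
  have h0 : D.IsEdge x x i := B.isEdge_iff.2 ⟨hx, .inl rfl⟩
  by_cases hz : D.IsEdge x z i
  · rw [B.sum_of_isEdge hx _ fun y hy ↦ by rw [EdgeFamily.edge_eq_zero _ _ _ _ hy, zero_mul],
      loopFamily_edge_mul_edge, loopFamily_edge_mul_edge, B.entry_mul_entry w h0 hz,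
      B.entry_mul_entry w (B.isEdge_symm h1) (B.isEdge_trans (B.isEdge_symm h1) hz), d_act_self,
      ← Matrix.single_add, ← add_mul, w.loop_add i (B.d_eq_or hx), one_mul]
    rfl
  · rw [EdgeFamily.edge_eq_zero _ _ _ _ hz]
    refine Finset.sum_eq_zero fun y _ ↦ ?_
    by_cases hy : D.IsEdge x y i
    · rw [EdgeFamily.edge_eq_zero _ i y z fun h ↦ hz (B.isEdge_trans hy h), mul_zero]
    · rw [EdgeFamily.edge_eq_zero _ _ _ _ hy, zero_mul]

lemma loopFamily_gen_mul_gen {i j : Fin D.rank} (h : D.coxMatrix i j = 2) :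
    (B.loopFamily w).gen i * (B.loopFamily w).gen j =
      (B.loopFamily w).gen j * (B.loopFamily w).gen i := by
  refine EdgeFamily.gen_mul_gen_comm _ B h fun ε δ x hi hj ↦ ?_
  have h' : D.coxMatrix j i = 2 := by rw [D.coxMatrix.symmetric, h]
  rw [loopFamily_edge_mul_edge, loopFamily_edge_mul_edge, B.step_comm h, B.entry_step w hi,
    B.entry_step w hj, ← B.step_comm h, B.entry_step w (by rwa [B.d_step_comm h]),
    B.step_comm h, B.entry_step w (by rwa [B.d_step_comm h']), B.d_step_comm h,
    B.d_step_comm h', mul_comm]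

/-- For `m = 4` too this holds for the full matrices, with no idempotents inserted, so it remains
available after tensoring with the matrix units of arbitrary edges. -/
lemma loopFamily_gen_mul_gen_mul_gen {i j : Fin D.rank} (h : D.Adj i j) :
    (B.loopFamily w).gen i * (B.loopFamily w).gen j * (B.loopFamily w).gen i =
      (B.loopFamily w).gen i := by
  rcases h with h | ⟨h, hi⟩
  · refine EdgeFamily.gen_mul_gen_mul_gen _ B h fun x y z hj hy hz ↦ ?_
    have hdi := (B.isEdge_iff.1 hy).1
    have h1 := B.d_eq_neg_of_adj (.inl h) hdi hj
    rw [loopFamily_edge_mul_edge]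
    refine (Matrix.single_mul_single_same ..).trans ?_
    rw [B.entry_self w hj, mul_right_comm, B.entry_mul_entry w hy hz, mul_right_comm, h1,
      w.loop_mul (B.mem_short _ _ h) (B.mem_short j i (by rw [D.coxMatrix.symmetric, h]))
        (B.d_eq_or hdi), one_mul]
    rfl
  · have hij : i ≠ j := by rintro rfl; simp at h
    apply (B.loopFamily w).eq_of_vert_mul_mul_vert
    intro x z
    rw [EdgeFamily.vert_mul_gen_mul_gen_mul_gen_mul_vert, EdgeFamily.vert_mul_gen_mul_vert,
      EdgeFamily.sum_edge_mul_edge_of_adj _ B (.inr ⟨h, hi⟩)]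
    by_cases hx : B.d i x = 0
    · have h : ∀ y, (B.loopFamily w).edge i x y = 0 := fun y ↦
        EdgeFamily.edge_eq_zero _ _ _ _ (by simp [B.isEdge_iff, hx])
      simp [h]
    have h1 : D.IsEdge x (B.act i x) i := B.isEdge_iff.2 ⟨hx, .inr rfl⟩
    have h0 : D.IsEdge x x i := B.isEdge_iff.2 ⟨hx, .inl rfl⟩
    have hsymm : D.coxMatrix j i = 4 := by rw [D.coxMatrix.symmetric, h]
    -- Here `j` is long, and its pairings at `x` and `x s_i` are both nonzero, with opposite signs.
    obtain ⟨hjs, hd⟩ : j ∉ D.short ∧ B.d j (B.act i x) = B.d j x + 2 * B.d i x := by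
      rcases B.cartan i j hij with h2 | h2 | ⟨-, -, h2, h3, -⟩ | h2
      · omega
      · omega
      · exact ⟨h2, by rw [d_act, h3]; ring⟩
      · exact absurd hi h2.2.1
    have hd1 := B.d_cases j x
    have hd2 := B.d_cases j (B.act i x)
    have hd3 := B.d_eq_or hx
    have hd4 : B.d j x = -B.d i x := by omega
    have hj0 : B.d j x ≠ 0 := by omega
    have hj1 : B.d j (B.act i x) ≠ 0 := by omega
    have hd5 : B.d j (B.act i x) = B.d i x := by omega
    by_cases hz : D.IsEdge x z i
    · have key : ∀ y, D.IsEdge y x i → D.IsEdge y z i → B.d j y ≠ 0 →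
          (B.loopFamily w).edge i x y * (B.loopFamily w).edge j y y * (B.loopFamily w).edge i y z =
          Matrix.single x z (w.loop i (B.d i y) * w.loop j (B.d j y) * B.entry w i x z) := by
        intro y hy hyz hj
        rw [loopFamily_edge_mul_edge]
        refine (Matrix.single_mul_single_same ..).trans ?_
        rw [B.entry_self w hj, mul_right_comm, B.entry_mul_entry w hy hyz, mul_right_comm]
      rw [B.sum_of_isEdge hx _ fun y hy ↦ by
          rw [EdgeFamily.edge_eq_zero _ _ _ _ hy, zero_mul, zero_mul],
        key x h0 hz hj0, key _ (B.isEdge_symm h1) (B.isEdge_trans (B.isEdge_symm h1) hz) hj1,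
        d_act_self, hd4, hd5, ← Matrix.single_add, ← add_mul, w.loop_mul_add hi hjs hd3, one_mul]
      rfl
    · rw [EdgeFamily.edge_eq_zero _ _ _ _ hz]
      refine Finset.sum_eq_zero fun y _ ↦ ?_
      by_cases hy : D.IsEdge x y i
      · rw [EdgeFamily.edge_eq_zero _ i y z fun h ↦ hz (B.isEdge_trans hy h), mul_zero]
      · rw [EdgeFamily.edge_eq_zero _ _ _ _ hy, zero_mul, zero_mul]

/-- The matrix of `E_ω` in the representation in which the generators are idempotents. -/
noncomputable def loopWord (ω : List (Fin D.rank)) : Matrix D.CosetRep D.CosetRep K :=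
  (ω.map (B.loopFamily w).gen).prod

/-- The row of `∅` in the matrix of a reduced word is unitriangular. -/
lemma Asc.loopWord_apply {B : BitModel D} {ω : List (Fin D.rank)} {μ : D.CosetRep} (h : B.Asc ω μ)
    {ν : D.CosetRep} (hν : D.cs.length μ.1 ≤ D.cs.length ν.1) :
    B.loopWord w ω D.vac ν = if ν = μ then 1 else 0 := by
  induction h generalizing ν with
  | nil => simp [loopWord, Matrix.one_apply, eq_comm]
  | @snoc ω μ i h hi ih =>
    have hl := B.length_act i μ
    have hl' := B.length_act i ν
    have h1 : B.loopWord w (ω ++ [i]) D.vac ν =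
        ∑ y, B.loopWord w ω D.vac y * B.entry w i y ν := by
      rw [loopWord, List.map_append, List.prod_append, List.map_singleton, List.prod_singleton,
        Matrix.mul_apply]
      exact Finset.sum_congr rfl fun y _ ↦ congrArg _ (matrixFamily_gen_apply _ _ i y ν)
    rw [h1]
    by_cases hd : B.d i ν = 0
    · rw [if_neg (by rintro rfl; rw [d_act_self] at hd; omega)]
      refine Finset.sum_eq_zero fun y _ ↦ ?_
      rw [B.entry_eq_zero w i y ν, mul_zero]
      exact fun hy ↦ (B.isEdge_iff.1 (B.isEdge_symm hy)).1 hd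
    -- As `ν` is longer than `μ`, the source `ν` itself contributes nothing; only `act i ν` can,
    -- when it is `μ`.
    · have := B.d_eq_or hd
      rw [B.sum_of_isEdge hd _ fun y hy ↦ by
        rw [B.entry_eq_zero w i y ν fun h ↦ hy (B.isEdge_symm h), mul_zero],
        ih (by omega), ih (by omega), if_neg (by rintro rfl; omega), zero_mul, zero_add]
      by_cases h2 : ν = B.act i μ
      · subst h2
        have h3 := B.entry_act w (i := i) (x := μ) (by omega)
        rw [act_act, if_pos rfl, if_pos rfl, h3, if_pos hi, one_mul]
      · rw [if_neg h2, if_neg, zero_mul]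
        rintro rfl
        simp at h2

variable [Algebra (LaurentPolynomial ℤ) K]

open Classical in
/-- The matrix coefficients of a representation of the Temperley--Lieb algebra. -/
noncomputable def coefficient (i : Fin D.rank) (x y : D.CosetRep) :
    Matrix D.CosetRep D.CosetRep K :=
  if D.IsEdge x y i then (T (B.deg i x y) : LaurentPolynomial ℤ) • (B.loopFamily w).gen i else 0

lemma coefficient_eq_zero (i : Fin D.rank) (x y : D.CosetRep) (h : ¬ D.IsEdge x y i) :
    B.coefficient w i x y = 0 := by simp [coefficient, h]

lemma coefficient_of_isEdge {i : Fin D.rank} {x y : D.CosetRep} (h : D.IsEdge x y i) :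
    B.coefficient w i x y = (T (B.deg i x y) : LaurentPolynomial ℤ) • (B.loopFamily w).gen i := by
  simp [coefficient, h]

/-- The edges of the extended Bruhat graph, acting by matrices of matrices. -/
noncomputable def repFamily :
    D.EdgeFamily (Matrix D.CosetRep D.CosetRep (Matrix D.CosetRep D.CosetRep K)) :=
  matrixFamily (B.coefficient w) (B.coefficient_eq_zero w)

/-- The outer matrix unit records the vertices, the power of `q` the degree, and the inner matrix
only the label. Each relation thus splits into additivity of degrees and a relation between
idempotents. -/
lemma repFamily_isTL : (B.repFamily w).IsTL B where
  square i x y z hy hz := by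
    change Matrix.single _ _ _ * Matrix.single _ _ _ = _ • Matrix.single _ _ _
    rw [Matrix.single_mul_single_same, Matrix.smul_single,
      B.coefficient_of_isEdge w (B.isEdge_symm hy), B.coefficient_of_isEdge w hz,
      B.coefficient_of_isEdge w (B.isEdge_trans (B.isEdge_symm hy) hz), smul_mul_smul_comm,
      loopFamily_gen_mul_self, smul_smul, ← LaurentPolynomial.T_add, ← LaurentPolynomial.T_add,
      B.deg_square hy hz]
  comm i j h ε δ x hi hj := by
    have h' : D.coxMatrix j i = 2 := by rw [D.coxMatrix.symmetric, h]
    have h1 := B.deg_comm h ε δ hi hj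
    change Matrix.single _ _ _ * Matrix.single _ _ _ = Matrix.single _ _ _ * Matrix.single _ _ _
    rw [Matrix.single_mul_single_same, Matrix.single_mul_single_same,
      B.coefficient_of_isEdge w (B.isEdge_step hi), B.coefficient_of_isEdge w (B.isEdge_step hj),
      B.coefficient_of_isEdge w (B.isEdge_step (by rwa [B.d_step_comm h'])),
      B.coefficient_of_isEdge w (B.isEdge_step (by rwa [B.d_step_comm h])),
      smul_mul_smul_comm, smul_mul_smul_comm, ← LaurentPolynomial.T_add,
      ← LaurentPolynomial.T_add, h1, loopFamily_gen_mul_gen w B h, B.step_comm h]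
  adj i j h x y z hj hy hz := by
    change Matrix.single _ _ _ * Matrix.single _ _ _ * Matrix.single _ _ _ = Matrix.single _ _ _
    have hxx : D.IsEdge x x j := B.isEdge_iff.2 ⟨hj, .inl rfl⟩
    rw [Matrix.single_mul_single_same, Matrix.single_mul_single_same,
      B.coefficient_of_isEdge w (B.isEdge_symm hy), B.coefficient_of_isEdge w hz,
      B.coefficient_of_isEdge w hxx,
      B.coefficient_of_isEdge w (B.isEdge_trans (B.isEdge_symm hy) hz), smul_mul_smul_comm,
      smul_mul_smul_comm, ← LaurentPolynomial.T_add, ← LaurentPolynomial.T_add, B.deg_self,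
      B.deg_adj h hj hy hz, loopFamily_gen_mul_gen_mul_gen w B h]

lemma hom_pathElt {x y : D.CosetRep} (S : Quiver.Path x y) :
    (B.repFamily_isTL w).hom (D.pathElt S) = Matrix.single x y
      ((T (D.pathDeg S) : LaurentPolynomial ℤ) • B.loopWord w (D.pathWord S)) := by
  induction S with
  | nil =>
    rw [pathElt, EdgeFamily.IsTL.hom_one]
    simp [pathDeg, pathWord, loopWord, LaurentPolynomial.T_zero]
    rfl
  | @cons y z p e ih =>
    rw [pathElt_cons, map_mul, ih, EdgeFamily.IsTL.hom_edge]
    refine (Matrix.single_mul_single_same ..).trans ?_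
    rw [B.coefficient_of_isEdge w e.2, smul_mul_smul_comm, ← LaurentPolynomial.T_add, pathDeg,
      B.edgeDeg_eq_deg, pathWord, loopWord, loopWord, List.map_append, List.prod_append,
      List.map_singleton, List.prod_singleton]

include w in
/-- The elements of the paths with reduced weights are linearly independent. -/
lemma linearIndependent_pathElt
    (hK : Function.Injective (algebraMap (LaurentPolynomial ℤ) K))
    {S : ∀ y : D.CosetRep, Quiver.Path D.vac y} (hS : ∀ y, B.Asc (D.pathWord (S y)) y) :
    LinearIndependent (LaurentPolynomial ℤ)
      fun s : (Σ (y : D.CosetRep) (x : D.CosetRep), D.pathsLike x (S y)) ↦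
        D.pathElt s.2.2.1 := by
  classical
  refine LinearIndependent.of_comp (B.repFamily_isTL w).hom.toLinearMap ?_
  rw [linearIndependent_iff']
  intro s g hg
  by_contra! hne
  obtain ⟨a, ha, hga⟩ := hne
  -- Choose a longest `μ` among the terms with nonzero coefficient. By unitriangularity, the entry
  -- at outer position `(∅, λ)` and inner position `(∅, μ)` sees no other term.
  obtain ⟨m, hm, hmax⟩ := Finset.exists_max_image (s.filter fun a ↦ g a ≠ 0)
    (fun a ↦ D.cs.length a.1.1) ⟨a, by simp [ha, hga]⟩
  rw [Finset.mem_filter] at hm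
  have h1 := congrArg (fun M ↦ M D.vac m.2.1 D.vac m.1) hg
  simp only [Function.comp_apply, AlgHom.toLinearMap_apply, hom_pathElt, Matrix.sum_apply, Matrix.smul_apply,
    Matrix.zero_apply] at h1
  rw [Finset.sum_eq_single m] at h1
  · rw [Matrix.single_apply_same, Matrix.smul_apply, m.2.2.2, (hS m.1).loopWord_apply w le_rfl,
      if_pos rfl, smul_smul, Algebra.smul_def, mul_one, map_eq_zero_iff _ hK,
      (LaurentPolynomial.isUnit_T _).mul_left_eq_zero] at h1
    exact hm.2 h1
  · intro b hb hbm
    by_cases hgb : g b = 0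
    · rw [hgb, zero_smul]
    by_cases hx : b.2.1 = m.2.1
    · rw [← hx, Matrix.single_apply_same, Matrix.smul_apply, b.2.2.2, (hS b.1).loopWord_apply w
        (hmax b (by simp [hb, hgb])), if_neg, smul_zero, smul_zero]
      intro hy
      apply hbm
      obtain ⟨y, x, p, hp⟩ := b
      obtain ⟨y', x', p', hp'⟩ := m
      obtain rfl : y' = y := hy
      obtain rfl : x = x' := hx
      obtain rfl : p = p' := (hS y').path_unique hp hp'
      rfl
    · rw [Matrix.single_apply_of_col_ne _ _ hx, Matrix.zero_apply, smul_zero]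
  · exact fun h ↦ absurd hm.1 h

end BitModel

/-- Suitable loop weights exist over the algebraic closure of the field of rational functions. -/
lemma exists_loopWeights : ∃ (K : Type) (_ : Field K) (_ : Algebra (LaurentPolynomial ℤ) K),
    Function.Injective (algebraMap (LaurentPolynomial ℤ) K) ∧ Nonempty (LoopWeights K) := by
  let F := FractionRing (LaurentPolynomial ℤ)
  let K := AlgebraicClosure F
  have hinj : Function.Injective (algebraMap (LaurentPolynomial ℤ) K) := by
    rw [IsScalarTower.algebraMap_eq (LaurentPolynomial ℤ) F K]
    exact (algebraMap F K).injective.comp (IsFractionRing.injective _ _)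
  refine ⟨K, inferInstance, inferInstance, hinj, ?_⟩
  have h3 : (3 : K) ≠ 0 := by
    have h : (3 : LaurentPolynomial ℤ) ≠ 0 := by
      intro h
      have := congrArg (fun p : LaurentPolynomial ℤ ↦ p.coeff 0) h
      rw [show (3 : LaurentPolynomial ℤ) = C 3 by simp] at this
      simp at this
    rw [← map_ofNat (algebraMap (LaurentPolynomial ℤ) K) 3]
    exact (map_ne_zero_iff _ hinj).2 h
  obtain ⟨ζ, hζ⟩ := IsAlgClosed.exists_root
    (Polynomial.X ^ 2 - Polynomial.X + Polynomial.C 1 : Polynomial K) (by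
      rw [show (Polynomial.X ^ 2 - Polynomial.X + Polynomial.C 1 : Polynomial K).degree = 2 by
        compute_degree!]
      norm_num)
  have hζ' : ζ ^ 2 - ζ + 1 = 0 := by simpa [Polynomial.IsRoot] using hζ
  -- The square of `2ζ - 1` is `4(ζ² - ζ + 1) - 3 = -3`.
  have hs : 2 * ζ - 1 ≠ 0 := by
    intro h
    apply h3
    linear_combination (-(2 * ζ - 1)) * h + 4 * hζ'
  -- `θ` is the solution of `hθ`, which is linear in `θ` with leading coefficient `1 - 2ζ`.
  exact ⟨⟨ζ, (ζ - 1) / (2 * ζ - 1), by linear_combination -hζ',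
    by linear_combination -div_mul_cancel₀ (ζ - 1) hs⟩⟩

end Representation

end ParabolicDatum

/-! ### The models for types A, C and D. -/

namespace BitMove

lemma cartan_swap_swap (p r : ℕ) : (swap p).cartan (swap r) =
    if p = r then 2 else if p + 1 = r ∨ r + 1 = p then -1 else 0 := by
  simp only [cartan, pair, root, Pi.sub_apply, Pi.single_apply, Pi.zero_apply]
  grind

/-- The asymmetry with `cartan_flip_swap` is the double bond: the swap is short and the flip long.
-/
lemma cartan_swap_flip (p : ℕ) : (swap p).cartan flip = if p = 0 then -2 else 0 := by
  simp only [cartan, pair, root, Pi.sub_apply, Pi.single_apply, Pi.zero_apply]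
  grind

lemma cartan_flip_swap (p : ℕ) : flip.cartan (swap p) = if p = 0 then -1 else 0 := by
  simp only [cartan, pair, root, Pi.single_apply, Pi.zero_apply]
  grind

lemma cartan_swap_flipPair (p : ℕ) : (swap p).cartan flipPair = if p = 1 then -1 else 0 := by
  simp only [cartan, pair, root, Pi.sub_apply, Pi.single_apply, Pi.zero_apply]
  grind

lemma cartan_flipPair_swap (p : ℕ) : flipPair.cartan (swap p) = if p = 1 then -1 else 0 := by
  simp only [cartan, pair, root, Pi.add_apply, Pi.single_apply, Pi.zero_apply]
  grind

lemma root_swap_eq_zero {p r : ℕ} (h : p + 1 < r) : (swap p).root r = 0 := by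
  simp [root, show r ≠ p by omega, show r ≠ p + 1 by omega]

lemma sum_weight_mul_root_swap (c : ℤ) {p N : ℕ} (h : p + 1 < N) :
    ∑ r ∈ Finset.range N, ((r : ℤ) + c) * (swap p).root r = 1 := by
  simp only [root, Pi.sub_apply, Pi.single_apply, mul_sub, Finset.sum_sub_distrib, mul_ite, mul_one,
    mul_zero, Finset.sum_ite_eq', Finset.mem_range, h, show p < N by omega, if_true]
  push_cast
  ring

end BitMove

namespace ParabolicDatum

open BitMove

/-- In type `A`, the simple reflections exchange adjacent entries. -/
def bitModelA (n : ℕ) (k : Fin n) : BitModel (typeA n k) where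
  move := fun i : Fin n ↦ swap i
  -- Nodes are counted from 0, so there are `k + 1` ones, and the only unequal neighbours are at
  -- `k`, the omitted node.
  init p := if p ≤ k then 1 else 0
  size := n + 1
  weight p := p + 0
  init_bits p := by dsimp only; split_ifs <;> simp
  init_eq_zero p hp := by rw [if_neg (by omega)]
  root_eq_zero := fun (i : Fin n) p hp ↦ root_swap_eq_zero (by omega)
  weight_root := fun i : Fin n ↦ sum_weight_mul_root_swap 0 (by omega)
  cartan := fun (i j : Fin n) hij ↦ by
    have h : (typeA n k).coxMatrix i j =
        if i = j then 1 else (if (j : ℕ) + 1 = i ∨ (i : ℕ) + 1 = j then 3 else 2) := rfl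
    have hij' : (i : ℕ) ≠ j := fun h ↦ hij (Fin.ext h)
    -- Matrix entry and shortness are abstracted to a number and two propositions, leaving a case
    -- check on natural numbers.
    have key : ∀ (m : ℕ) (s t : Prop),
        m = (if (j : ℕ) + 1 = i ∨ (i : ℕ) + 1 = j then 3 else 2) →
        (s ↔ True) → (t ↔ True) →
        (m = 2 ∧ (swap i).cartan (swap j) = 0 ∧ (swap j).cartan (swap i) = 0) ∨
        (m = 3 ∧ (swap i).cartan (swap j) = -1 ∧ (swap j).cartan (swap i) = -1) ∨
        (m = 4 ∧ s ∧ ¬t ∧ (swap i).cartan (swap j) = -2 ∧ (swap j).cartan (swap i) = -1) ∨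
        (m = 4 ∧ ¬s ∧ t ∧ (swap i).cartan (swap j) = -1 ∧ (swap j).cartan (swap i) = -2) := by
      rintro m s t rfl hs ht
      rw [cartan_swap_swap, cartan_swap_swap]
      grind
    exact key _ _ _ (h.trans (if_neg hij)) Iff.rfl Iff.rfl
  mem_short _ _ _ := Set.mem_univ _
  pair_init := fun i : Fin n ↦ by
    have key : ∀ s : Prop, (s ↔ (i : ℕ) ≠ k) →
        (s ∧ (swap i).pair (fun p ↦ if p ≤ k then 1 else 0) = 0) ∨
        (¬s ∧ (swap i).pair (fun p ↦ if p ≤ k then 1 else 0) = 1) := by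
      intro s hs
      simp only [pair]
      grind
    exact key _ (not_congr Fin.ext_iff)

/-- The moves by which the simple reflections act in type `C`. -/
def moveC (n i : ℕ) : BitMove := if i + 1 = n then BitMove.flip else swap (n - 2 - i)

/-- In type `C`, the last simple reflection flips the first entry. -/
def bitModelC (n : ℕ) (hn : 2 ≤ n) : BitModel (typeC n) where
  move := fun i : Fin n ↦ moveC n i
  init _ := 0
  size := n
  -- Swaps only see differences of weights; the shift gives entry 0, the root of the flip, weight
  -- one.
  weight p := p + 1
  init_bits p := .inl rfl
  init_eq_zero p hp := rfl
  root_eq_zero := fun (i : Fin n) p hp ↦ by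
    unfold moveC
    split_ifs
    · simp [root, show p ≠ 0 by omega]
    · exact root_swap_eq_zero (by omega)
  weight_root := fun i : Fin n ↦ by
    unfold moveC
    split_ifs
    · rw [Finset.sum_eq_single 0]
      · simp [root]
      · intro p _ hp
        simp [root, hp]
      · simp; omega
    · exact sum_weight_mul_root_swap 1 (by omega)
  cartan := fun (i j : Fin n) hij ↦ by
    have h : (typeC n).coxMatrix i j = if i = j then 1
      else (if (i : ℕ) = n - 1 ∧ (j : ℕ) = n - 2 ∨ (j : ℕ) = n - 1 ∧ (i : ℕ) = n - 2 then 4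
        else (if (j : ℕ) + 1 = i ∨ (i : ℕ) + 1 = j then 3 else 2)) := rfl
    have hij' : (i : ℕ) ≠ j := fun h ↦ hij (Fin.ext h)
    have hi := i.2
    have hj := j.2
    have key : ∀ (m : ℕ) (s t : Prop),
        m = (if (i : ℕ) = n - 1 ∧ (j : ℕ) = n - 2 ∨ (j : ℕ) = n - 1 ∧ (i : ℕ) = n - 2 then 4
          else (if (j : ℕ) + 1 = i ∨ (i : ℕ) + 1 = j then 3 else 2)) →
        (s ↔ (i : ℕ) + 1 ≠ n) → (t ↔ (j : ℕ) + 1 ≠ n) →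
        (m = 2 ∧ (moveC n i).cartan (moveC n j) = 0 ∧ (moveC n j).cartan (moveC n i) = 0) ∨
        (m = 3 ∧ (moveC n i).cartan (moveC n j) = -1 ∧
          (moveC n j).cartan (moveC n i) = -1) ∨
        (m = 4 ∧ s ∧ ¬t ∧ (moveC n i).cartan (moveC n j) = -2 ∧
          (moveC n j).cartan (moveC n i) = -1) ∨
        (m = 4 ∧ ¬s ∧ t ∧ (moveC n i).cartan (moveC n j) = -1 ∧
          (moveC n j).cartan (moveC n i) = -2) := by
      rintro m s t rfl hs ht
      by_cases h1 : (i : ℕ) + 1 = n <;> by_cases h2 : (j : ℕ) + 1 = n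
      · omega
      · simp only [moveC, h1, h2, if_true, if_false, cartan_swap_flip, cartan_flip_swap]
        grind
      · simp only [moveC, h1, h2, if_true, if_false, cartan_swap_flip, cartan_flip_swap]
        grind
      · simp only [moveC, h1, h2, if_false, cartan_swap_swap]
        grind
    exact key _ _ _ (h.trans (if_neg hij)) Iff.rfl Iff.rfl
  mem_short := fun (i j : Fin n) hij ↦ by
    have h : (typeC n).coxMatrix i j = if i = j then 1
      else (if (i : ℕ) = n - 1 ∧ (j : ℕ) = n - 2 ∨ (j : ℕ) = n - 1 ∧ (i : ℕ) = n - 2 then 4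
        else (if (j : ℕ) + 1 = i ∨ (i : ℕ) + 1 = j then 3 else 2)) := rfl
    rw [h] at hij
    change (i : ℕ) + 1 ≠ n
    intro hi
    have := j.2
    split_ifs at hij <;> omega
  pair_init := fun i : Fin n ↦ by
    have key : ∀ s : Prop, (s ↔ (i : ℕ) + 1 ≠ n) →
        (s ∧ (moveC n i).pair (fun _ ↦ 0) = 0) ∨ (¬s ∧ (moveC n i).pair (fun _ ↦ 0) = 1) := by
      intro s hs
      by_cases h1 : (i : ℕ) + 1 = n <;> simp [moveC, h1, hs, pair]
    exact key _ Iff.rfl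

/-- The moves by which the simple reflections act in type `D`. -/
def moveD (i : ℕ) : BitMove := if i = 0 then flipPair else swap (i - 1)

/-- In type `D`, the node of the fork outside of the parabolic flips the first two entries. -/
def bitModelD (n : ℕ) (hn : 2 ≤ n) : BitModel (typeD n) where
  move := fun i : Fin n ↦ moveD i
  init _ := 0
  size := n
  -- Entries 0 and 1 have weights 0 and 1, so the root of `flipPair` has weight one without a shift.
  weight p := p + 0
  init_bits p := .inl rfl
  init_eq_zero p hp := rfl
  root_eq_zero := fun (i : Fin n) p hp ↦ by
    unfold moveD
    split_ifs
    · simp [root, show p ≠ 0 by omega, show p ≠ 1 by omega]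
    · exact root_swap_eq_zero (by omega)
  weight_root := fun i : Fin n ↦ by
    unfold moveD
    split_ifs
    · rw [Finset.sum_eq_single 1]
      · simp [root]
      · intro p _ hp
        by_cases h0 : p = 0
        · simp [h0]
        · simp [root, hp, h0]
      · simp; omega
    · exact sum_weight_mul_root_swap 0 (by omega)
  cartan := fun (i j : Fin n) hij ↦ by
    have h : (typeD n).coxMatrix i j = if i = j then 1
      else if ((i : ℕ) = 0 ∧ (j : ℕ) = 2) ∨ ((j : ℕ) = 0 ∧ (i : ℕ) = 2) then 3
      else if (1 ≤ (i : ℕ) ∧ (i : ℕ) + 1 = j) ∨ (1 ≤ (j : ℕ) ∧ (j : ℕ) + 1 = i) then 3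
      else 2 := rfl
    have hij' : (i : ℕ) ≠ j := fun h ↦ hij (Fin.ext h)
    have key : ∀ (m : ℕ) (s t : Prop),
        m = (if ((i : ℕ) = 0 ∧ (j : ℕ) = 2) ∨ ((j : ℕ) = 0 ∧ (i : ℕ) = 2) then 3
          else if (1 ≤ (i : ℕ) ∧ (i : ℕ) + 1 = j) ∨ (1 ≤ (j : ℕ) ∧ (j : ℕ) + 1 = i) then 3
          else 2) →
        (s ↔ True) → (t ↔ True) →
        (m = 2 ∧ (moveD i).cartan (moveD j) = 0 ∧ (moveD j).cartan (moveD i) = 0) ∨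
        (m = 3 ∧ (moveD i).cartan (moveD j) = -1 ∧ (moveD j).cartan (moveD i) = -1) ∨
        (m = 4 ∧ s ∧ ¬t ∧ (moveD i).cartan (moveD j) = -2 ∧ (moveD j).cartan (moveD i) = -1) ∨
        (m = 4 ∧ ¬s ∧ t ∧ (moveD i).cartan (moveD j) = -1 ∧ (moveD j).cartan (moveD i) = -2) := by
      rintro m s t rfl hs ht
      by_cases h1 : (i : ℕ) = 0 <;> by_cases h2 : (j : ℕ) = 0
      · omega
      · simp only [moveD, h1, h2, if_true, if_false, cartan_swap_flipPair, cartan_flipPair_swap]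
        grind
      · simp only [moveD, h1, h2, if_true, if_false, cartan_swap_flipPair, cartan_flipPair_swap]
        grind
      · simp only [moveD, h1, h2, if_false, cartan_swap_swap]
        grind
    exact key _ _ _ (h.trans (if_neg hij)) Iff.rfl Iff.rfl
  mem_short _ _ _ := Set.mem_univ _
  pair_init := fun i : Fin n ↦ by
    have key : ∀ s : Prop, (s ↔ (i : ℕ) ≠ 0) →
        (s ∧ (moveD i).pair (fun _ ↦ 0) = 0) ∨ (¬s ∧ (moveD i).pair (fun _ ↦ 0) = 1) := by
      intro s hs
      by_cases h1 : (i : ℕ) = 0 <;> simp [moveD, h1, hs, pair]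
    exact key _ Iff.rfl

lemma IsClassicalACD.exists_bitModel {D : ParabolicDatum} (hD : D.IsClassicalACD) :
    Nonempty (BitModel D) := by
  rcases hD with ⟨n, k, rfl⟩ | ⟨n, hn, rfl⟩ | ⟨n, hn, rfl⟩
  exacts [⟨bitModelA n k⟩, ⟨bitModelC n hn⟩, ⟨bitModelD n hn⟩]

/-! ### The basis and the main theorem. -/

variable {D : ParabolicDatum}

lemma BitModel.span_pathElt (B : BitModel D) [Fintype D.CosetRep] [DecidableEq D.CosetRep]
    {S : ∀ y : D.CosetRep, Quiver.Path D.vac y} (hS : ∀ y, B.Asc (D.pathWord (S y)) y) :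
    Submodule.span (LaurentPolynomial ℤ) (Set.range
      fun s : (Σ (y : D.CosetRep) (x : D.CosetRep), D.pathsLike x (S y)) ↦
        D.pathElt s.2.2.1) = D.antispherical := by
  rw [B.antispherical_eq]
  apply le_antisymm
  · refine Submodule.span_le.2 ?_
    rintro _ ⟨⟨y, x, p, hp⟩, rfl⟩
    exact Submodule.subset_span ⟨_, y, x, hS y, ((hS y).wordElt_eq x).1 p hp⟩
  · refine Submodule.span_le.2 ?_
    rintro _ ⟨ω, y, x, h, rfl⟩
    rw [h.wordElt_congr (hS y)]
    by_cases hx : D.Reach (D.pathWord (S y)) x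
    · obtain ⟨p, hp⟩ := hx
      rw [← ((hS y).wordElt_eq x).1 p hp]
      exact Submodule.subset_span ⟨⟨y, x, p, hp⟩, rfl⟩
    · rw [((hS y).wordElt_eq x).2 hx]
      exact zero_mem _

lemma BitModel.exists_basis (B : BitModel D) [Fintype D.CosetRep] [DecidableEq D.CosetRep]
    {S : ∀ y : D.CosetRep, Quiver.Path D.vac y} (hS : ∀ y, B.Asc (D.pathWord (S y)) y) :
    ∃ b : Module.Basis (Σ (y : D.CosetRep) (x : D.CosetRep), D.pathsLike x (S y))
        (LaurentPolynomial ℤ) D.antispherical,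
      ∀ s, (b s : D.TL) = D.pathElt s.2.2.1 := by
  obtain ⟨K, _, _, hK, ⟨w⟩⟩ := exists_loopWeights
  have hli := B.linearIndependent_pathElt w hK hS
  rw [← B.span_pathElt hS]
  exact ⟨Module.Basis.span hli, fun s ↦ congrArg Subtype.val (Module.Basis.span_apply hli s)⟩

end ParabolicDatum

theorem mainTheorem3 (D : ParabolicDatum) (hD : D.IsClassicalACD)
    (T : ∀ y : D.CosetRep, Quiver.Path D.vac y) (hT : ∀ y : D.CosetRep, D.IsReducedPath (T y)) :
    -- the components of degree `d`, for integers `d`, form a grading of the algebra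
    DirectSum.IsInternal D.component ∧
    -- the elements `e_S`, for `S` in `Path(x, T y)`, form a basis of the anti-spherical module
    (∃ b : Module.Basis (Σ (y : D.CosetRep) (x : D.CosetRep), D.pathsLike x (T y))
        (LaurentPolynomial ℤ) D.antispherical,
      ∀ s, (b s : D.TL) = D.pathElt s.2.2.1) ∧
    -- `e_S = ∅ e_y x`, where `e_y` is computed from any reduced expression of `y`
    (∀ (x y : D.CosetRep), ∀ S ∈ D.pathsLike x (T y), ∀ ω : List (Fin D.rank),
      D.cs.IsReduced ω → D.cs.wordProd ω = y.1 →
        D.pathElt S = D.one D.vac * D.wordE ω * D.one x) ∧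
    -- `deg e_S = deg S`
    (∀ (x y : D.CosetRep), ∀ S ∈ D.pathsLike x (T y), D.pathElt S ∈ D.component (D.pathDeg S)) ∧
    -- there is at most one path in `Path(x, T y)`
    (∀ x y : D.CosetRep, (D.pathsLike x (T y)).encard ≤ 1) := by
  classical
  obtain ⟨B⟩ := hD.exists_bitModel
  have := B.finite_cosetRep
  have := Fintype.ofFinite D.CosetRep
  have hT' := fun y ↦ B.asc_of_isReducedPath (hT y)
  refine ⟨ParabolicDatum.isInternal_component B, B.exists_basis hT', ?_, ?_, ?_⟩
  · intro x y S hS ω hω hy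
    rw [((hT' y).wordElt_eq x).1 S hS, (hT' y).wordElt_congr (B.asc_of_isReduced hω hy)]
    rfl
  · intro x y S _
    exact ParabolicDatum.pathElt_mem_component S
  · intro x y
    exact Set.encard_le_one_iff.2 fun S S' hS hS' ↦ (hT' y).path_unique hS hS'
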